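/- Let $0<L<\infty$, $\lambda_1,\lambda_2>0$, and let $\mu_1,\mu_2\ge 0$ be functions on $[0,L)$ such that, for $i=1,2$, $\int_0^l\mu_i(x)\,dx<\infty$ for all $0<l<L$, $\int_0^L\mu_i(x)\,dx=\infty$, and, for some positive integer $N$, the limit $\lim_{x\to L^-}\mu_i(x)(L-x)^N$ exists and is finite for $i=1,2$. Let $X=\mathbb R\times L^1(0,L)\times L^1(0,L)$ (real spaces) with $\|p\|_X=|p_0|+\|p_1\|_{L^1}+\|p_2\|_{L^1}$, and call $p\in X$ nonnegative if $p_0\ge0$ and $p_1,p_2\ge 0$ almost everywhere. Let $\mathcal A:D(\mathcal A)\subset X\to X$ be the operator $$\mathcal A p=\Big(-(\lambda_1+\lambda_2)p_0+\sum_{i=1}^2\int_0^L\mu_ip_i\,dx,\ -p_1'-(\mu_1+\lambda_2)p_1,\ -p_2'-\mu_2p_2\Big),$$ whose domain $D(\mathcal A)$ consists of all $p=(p_0,p_1,p_2)\in X$ with $p_i\in W^{1,1}(0,L)$ and $\mu_ip_i\in L^1(0,L)$ for $i=1,2$, $p_1(0)=\lambda_1p_0$, and $p_2(0)=\lambda_2p_0+\lambda_2\int_0^Lp_1(x)\,dx$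 (boundary values of the continuous representatives). Then there is a $C_0$-semigroup $(\mathcal T(t))_{t\ge0}$ on $X$ with generator $\mathcal A$, such that for every nonnegative $\vec p_0\in X$ the following hold. 1. The function $\vec p(t)=\mathcal T(t)\vec p_0$ is the unique mild solution on $[0,\infty)$ of the Cauchy problem $\dot{\vec p}(t)=\mathcal A\vec p(t)$, $\vec p(0)=\vec p_0$. Here a mild solution is a continuous $\vec p:[0,\infty)\to X$ such that, for all $t\ge0$, $\int_0^t\vec p(s)\,ds\in D(\mathcal A)$ and $\vec p(t)=\vec p_0+\mathcal A\int_0^t\vec p(s)\,ds$. 2. If moreover $\vec p_0\in D(\mathcal A)$, then $\vec p$ is a classical solution, that is, $\vec p\in C^1([0,\infty);X)$ (with the right derivative at $t=0$), $\vec p(0)=\vec p_0$, and $\vec p(t)\in D(\mathcal A)$ and $\dot{\vec p}(t)=\mathcal A\vec p(t)$ for all $t\ge0$. Every classical solution of the Cauchy problem with initial value $\vec p_0$ coincides with $\vec p$. 3. $\vec p(t)$ is nonnegative for all $t\ge0$. 4. If $\|\vec p_0\|_X=1$, then $\|\vec p(t)\|_X\le1$ for all $t\ge0$. -/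

import Mathlib

open Set Filter Topology MeasureTheory
open scoped ContDiff

namespace RepairableSystem

section AbstractCauchyProblem

variable {E : Type*} [NormedAddCommGroup E] [NormedSpace ℝ E]

/-- A `C₀`-semigroup `(T t)_{t ≥ 0}` of bounded operators on `E` (values at `t < 0` are irrelevant):
`T 0 = I`, `T (s + t) = T s T t`, and `T t x → x` as `t ↓ 0` for every `x`. -/
structure IsC0Semigroup (T : ℝ → E →L[ℝ] E) : Prop where
  map_zero : T 0 = ContinuousLinearMap.id ℝ E
  map_add : ∀ s t : ℝ, 0 ≤ s → 0 ≤ t → T (s + t) = (T s).comp (T t)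
  tendsto_zero : ∀ x : E, Tendsto (fun t => T t x) (𝓝[>] 0) (𝓝 x)

/-- The unbounded operator `A` is the infinitesimal generator of `T`: `x ∈ D(A)` and `A x = y`
exactly when `(T h x - x) / h → y` as `h ↓ 0`. -/
def IsGenerator (T : ℝ → E →L[ℝ] E) (A : E →ₗ.[ℝ] E) : Prop :=
  ∀ x y : E, (x, y) ∈ A.graph ↔ Tendsto (fun h : ℝ => h⁻¹ • (T h x - x)) (𝓝[>] 0) (𝓝 y)

/-- `u` is a mild solution on `[0, ∞)` of the Cauchy problem `u' = A u`, `u 0 = x`: it is continuous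
and, for every `t ≥ 0`, `∫₀ᵗ u ∈ D(A)` and `u t = x + A ∫₀ᵗ u`. -/
structure IsMildSolution (A : E →ₗ.[ℝ] E) (x : E) (u : ℝ → E) : Prop where
  continuousOn : ContinuousOn u (Ici 0)
  integral_eq : ∀ t : ℝ, 0 ≤ t → (∫ s in (0 : ℝ)..t, u s, u t - x) ∈ A.graph

/-- `u` is a classical solution on `[0, ∞)` of the Cauchy problem `u' = A u`, `u 0 = x`: it is
continuously differentiable, `u t ∈ D(A)` and `u' t = A (u t)` for every `t ≥ 0` (with the right
derivative at `t = 0`), and `u 0 = x`. -/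
structure IsClassicalSolution (A : E →ₗ.[ℝ] E) (x : E) (u : ℝ → E) : Prop where
  initial : u 0 = x
  exists_deriv : ∃ u' : ℝ → E, ContinuousOn u' (Ici 0) ∧
    ∀ t : ℝ, 0 ≤ t → HasDerivWithinAt u (u' t) (Ici 0) t ∧ (u t, u' t) ∈ A.graph

end AbstractCauchyProblem

/-- The real space `L¹(0, L)`. -/
abbrev L1 (L : ℝ) : Type := Lp ℝ 1 (volume.restrict (Ioo (0 : ℝ) L))

/-- The state space `X = ℝ × L¹(0, L) × L¹(0, L)` with the norm
`‖p‖ = |p₀| + ‖p₁‖ + ‖p₂‖`. -/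
abbrev X (L : ℝ) : Type := WithLp 1 (ℝ × WithLp 1 (L1 L × L1 L))

/-- The component `p₀` of a state. -/
def p₀ {L : ℝ} (p : X L) : ℝ := p.fst

/-- The component `p₁` of a state. -/
def p₁ {L : ℝ} (p : X L) : L1 L := p.snd.fst

/-- The component `p₂` of a state. -/
def p₂ {L : ℝ} (p : X L) : L1 L := p.snd.snd

/-- The norm of `X` is the intended one. -/
theorem norm_eq {L : ℝ} (p : X L) : ‖p‖ = |p₀ p| + ‖p₁ p‖ + ‖p₂ p‖ := by
  rw [WithLp.prod_norm_eq_of_L1, WithLp.prod_norm_eq_of_L1, ← add_assoc]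
  rfl

/-- The order of the Banach lattice `X`, `p ≥ 0`: `p₀ ≥ 0` and `p₁, p₂ ≥ 0` almost everywhere. -/
def IsNonneg {L : ℝ} (p : X L) : Prop := 0 ≤ p₀ p ∧ 0 ≤ p₁ p ∧ 0 ≤ p₂ p

/-- `g ∈ L¹(0, L)` is the weak derivative on `(0, L)` of `f ∈ L¹(0, L)`; thus `f ∈ W^{1,1}(0, L)`
exactly when such a `g` exists. -/
def IsWeakDeriv {L : ℝ} (f g : L1 L) : Prop :=
  ∀ φ : ℝ → ℝ, ContDiff ℝ ∞ φ → HasCompactSupport φ → tsupport φ ⊆ Ioo 0 L →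
    ∫ x in Ioo 0 L, f x * deriv φ x = -∫ x in Ioo 0 L, g x * φ x

/-- The (trace) value of `f` at `x = 0` is `c`: the value at `0` of a representative of `f` that is
continuous on `[0, L]`. -/
def HasValueAtZero {L : ℝ} (f : L1 L) (c : ℝ) : Prop :=
  ∃ u : ℝ → ℝ, ContinuousOn u (Icc 0 L) ∧ (f =ᵐ[volume.restrict (Ioo 0 L)] u) ∧ u 0 = c

/-- `μ` is an admissible repair rate with singularity exponent `N` at `L`. -/
structure IsRepairRate (L : ℝ) (N : ℕ) (μ : ℝ → ℝ) : Prop where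
  nonneg : ∀ x ∈ Ico 0 L, 0 ≤ μ x
  integrableOn : ∀ l : ℝ, 0 < l → l < L → IntegrableOn μ (Ioo 0 l)
  lintegral_eq_top : ∫⁻ x in Ioo 0 L, ENNReal.ofReal (μ x) = ⊤
  exists_tendsto : ∃ c : ℝ, Tendsto (fun x => μ x * (L - x) ^ N) (𝓝[<] L) (𝓝 c)

/-- The domain `D(𝒜)`: `p₁, p₂ ∈ W^{1,1}(0, L)`, `μ₁ p₁, μ₂ p₂ ∈ L¹(0, L)`, `p₁(0) = λ₁ p₀` and
`p₂(0) = λ₂ p₀ + λ₂ ∫₀ᴸ p₁ dx`. -/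
structure InDomain {L : ℝ} (lam₁ lam₂ : ℝ) (μ₁ μ₂ : ℝ → ℝ) (p : X L) : Prop where
  sobolev₁ : ∃ g : L1 L, IsWeakDeriv (p₁ p) g
  sobolev₂ : ∃ g : L1 L, IsWeakDeriv (p₂ p) g
  integrable₁ : IntegrableOn (fun x => μ₁ x * p₁ p x) (Ioo 0 L)
  integrable₂ : IntegrableOn (fun x => μ₂ x * p₂ p x) (Ioo 0 L)
  boundary₁ : HasValueAtZero (p₁ p) (lam₁ * p₀ p)
  boundary₂ : HasValueAtZero (p₂ p) (lam₂ * p₀ p + lam₂ * ∫ x in Ioo 0 L, p₁ p x)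

/-- The relation `q = 𝒜 p` for the matrix of operators
`q₀ = -(λ₁ + λ₂) p₀ + ∫₀ᴸ μ₁ p₁ dx + ∫₀ᴸ μ₂ p₂ dx`, `q₁ = -(p₁' + μ₁ p₁ + λ₂ p₁)`,
`q₂ = -(p₂' + μ₂ p₂)`, the derivatives being weak. -/
structure IsImage {L : ℝ} (lam₁ lam₂ : ℝ) (μ₁ μ₂ : ℝ → ℝ) (p q : X L) : Prop where
  eq₀ : p₀ q = -(lam₁ + lam₂) * p₀ p + (∫ x in Ioo 0 L, μ₁ x * p₁ p x)
    + ∫ x in Ioo 0 L, μ₂ x * p₂ p x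
  eq₁ : ∃ g : L1 L, IsWeakDeriv (p₁ p) g ∧
    ∀ᵐ x ∂(volume.restrict (Ioo 0 L)), p₁ q x = -(g x + μ₁ x * p₁ p x + lam₂ * p₁ p x)
  eq₂ : ∃ g : L1 L, IsWeakDeriv (p₂ p) g ∧
    ∀ᵐ x ∂(volume.restrict (Ioo 0 L)), p₂ q x = -(g x + μ₂ x * p₂ p x)

theorem L1.integrable {L : ℝ} (f : L1 L) : IntegrableOn f (Ioo 0 L) := L1.integrable_coeFn f

theorem integrable_mul_of_compact {L : ℝ} (f : L1 L) {φ : ℝ → ℝ} (hφ : Continuous φ)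
    (hc : HasCompactSupport φ) : IntegrableOn (fun x => f x * φ x) (Ioo 0 L) := by
  obtain ⟨C, hC⟩ := hφ.bounded_above_of_compact_support hc
  exact (L1.integrable f).mul_bdd (c := C) hφ.aestronglyMeasurable (Eventually.of_forall hC)

theorem coeFn_zero_ae (L : ℝ) : ∀ᵐ x ∂(volume.restrict (Ioo 0 L)), (0 : L1 L) x = (0 : ℝ) := by
  filter_upwards [Lp.coeFn_zero ℝ 1 (volume.restrict (Ioo 0 L))] with x hx
  exact hx

theorem IsWeakDeriv.add {L : ℝ} {f g f' g' : L1 L} (h : IsWeakDeriv f g)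
    (h' : IsWeakDeriv f' g') : IsWeakDeriv (f + f') (g + g') := by
  intro φ h1 h2 h3
  have e : ∀ (a b : L1 L) (ψ : ℝ → ℝ), Continuous ψ → HasCompactSupport ψ →
      ∫ x in Ioo 0 L, (a + b : L1 L) x * ψ x =
        (∫ x in Ioo 0 L, a x * ψ x) + ∫ x in Ioo 0 L, b x * ψ x := by
    intro a b ψ hψ hc
    rw [← integral_add (integrable_mul_of_compact a hψ hc) (integrable_mul_of_compact b hψ hc)]
    apply integral_congr_ae
    filter_upwards [Lp.coeFn_add a b] with x hx
    rw [hx, Pi.add_apply, add_mul]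
  rw [e _ _ _ (h1.continuous_deriv (by simp)) h2.deriv, e _ _ _ h1.continuous h2,
    h φ h1 h2 h3, h' φ h1 h2 h3, neg_add]

theorem IsWeakDeriv.smul {L : ℝ} {f g : L1 L} (c : ℝ) (h : IsWeakDeriv f g) :
    IsWeakDeriv (c • f) (c • g) := by
  intro φ h1 h2 h3
  have e : ∀ (a : L1 L) (ψ : ℝ → ℝ),
      ∫ x in Ioo 0 L, (c • a : L1 L) x * ψ x = c * ∫ x in Ioo 0 L, a x * ψ x := by
    intro a ψ
    rw [← integral_const_mul]
    apply integral_congr_ae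
    filter_upwards [Lp.coeFn_smul c a] with x hx
    rw [hx, Pi.smul_apply, smul_eq_mul, mul_assoc]
  rw [e, e, h φ h1 h2 h3, mul_neg]

theorem IsWeakDeriv.zero {L : ℝ} : IsWeakDeriv (0 : L1 L) 0 := by
  intro φ _ _ _
  have e : ∀ ψ : ℝ → ℝ, ∫ x in Ioo 0 L, (0 : L1 L) x * ψ x = 0 := by
    intro ψ
    rw [integral_eq_zero_of_ae]
    filter_upwards [coeFn_zero_ae L] with x hx
    simp only [hx, mul_zero, zero_mul, Pi.zero_apply]
  rw [e, e, neg_zero]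

/-- A weak derivative is unique. -/
theorem IsWeakDeriv.unique {L : ℝ} {f g g' : L1 L} (h : IsWeakDeriv f g)
    (h' : IsWeakDeriv f g') : g = g' := by
  have hl : LocallyIntegrableOn (fun x => g x - g' x) (Ioo 0 L) volume :=
    ((L1.integrable g).sub (L1.integrable g')).locallyIntegrableOn
  have := isOpen_Ioo.ae_eq_zero_of_integral_contDiff_smul_eq_zero hl (by
    intro φ h1 h2 h3
    have hz : ∀ x, x ∉ Ioo 0 L → φ x • (g x - g' x) = 0 := by
      intro x hx
      rw [image_eq_zero_of_notMem_tsupport (fun hn => hx (h3 hn)), zero_smul]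
    rw [← setIntegral_eq_integral_of_forall_compl_eq_zero hz]
    have e : ∫ x in Ioo 0 L, φ x • (g x - g' x) =
        (∫ x in Ioo 0 L, g x * φ x) - ∫ x in Ioo 0 L, g' x * φ x := by
      rw [← integral_sub (integrable_mul_of_compact g h1.continuous h2)
        (integrable_mul_of_compact g' h1.continuous h2)]
      congr 1
      ext x
      simp only [smul_eq_mul]
      ring
    rw [e]
    linarith [h φ h1 h2 h3, h' φ h1 h2 h3])
  apply Lp.ext
  filter_upwards [ae_restrict_of_ae this, ae_restrict_mem measurableSet_Ioo] with x hx hm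
  linarith [hx hm]

theorem HasValueAtZero.add {L : ℝ} {f f' : L1 L} {c c' : ℝ} (h : HasValueAtZero f c)
    (h' : HasValueAtZero f' c') : HasValueAtZero (f + f') (c + c') := by
  obtain ⟨u, hu, e, rfl⟩ := h
  obtain ⟨v, hv, e', rfl⟩ := h'
  refine ⟨u + v, hu.add hv, ?_, rfl⟩
  filter_upwards [Lp.coeFn_add f f', e, e'] with x h1 h2 h3
  rw [h1, Pi.add_apply, Pi.add_apply, h2, h3]

theorem HasValueAtZero.smul {L : ℝ} {f : L1 L} {c : ℝ} (a : ℝ) (h : HasValueAtZero f c) :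
    HasValueAtZero (a • f) (a * c) := by
  obtain ⟨u, hu, e, rfl⟩ := h
  refine ⟨a • u, hu.const_smul a, ?_, rfl⟩
  filter_upwards [Lp.coeFn_smul a f, e] with x h1 h2
  rw [h1, Pi.smul_apply, Pi.smul_apply, h2]

theorem HasValueAtZero.zero {L : ℝ} : HasValueAtZero (0 : L1 L) 0 :=
  ⟨0, continuousOn_const, Lp.coeFn_zero ℝ 1 _, rfl⟩

theorem integral_add_eq {L : ℝ} (f g : L1 L) (m : ℝ → ℝ)
    (hf : IntegrableOn (fun x => m x * f x) (Ioo 0 L))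
    (hg : IntegrableOn (fun x => m x * g x) (Ioo 0 L)) :
    IntegrableOn (fun x => m x * (f + g : L1 L) x) (Ioo 0 L) ∧
    ∫ x in Ioo 0 L, m x * (f + g : L1 L) x =
      (∫ x in Ioo 0 L, m x * f x) + ∫ x in Ioo 0 L, m x * g x := by
  have e : (fun x => m x * (f + g : L1 L) x) =ᵐ[volume.restrict (Ioo 0 L)]
      (fun x => m x * f x + m x * g x) := by
    filter_upwards [Lp.coeFn_add f g] with x hx
    rw [hx, Pi.add_apply, mul_add]
  exact ⟨(hf.add hg).congr e.symm, by rw [integral_congr_ae e, integral_add hf hg]⟩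

theorem integral_smul_eq {L : ℝ} (c : ℝ) (f : L1 L) (m : ℝ → ℝ)
    (hf : IntegrableOn (fun x => m x * f x) (Ioo 0 L)) :
    IntegrableOn (fun x => m x * (c • f : L1 L) x) (Ioo 0 L) ∧
    ∫ x in Ioo 0 L, m x * (c • f : L1 L) x = c * ∫ x in Ioo 0 L, m x * f x := by
  have e : (fun x => m x * (c • f : L1 L) x) =ᵐ[volume.restrict (Ioo 0 L)]
      (fun x => c * (m x * f x)) := by
    filter_upwards [Lp.coeFn_smul c f] with x hx
    rw [hx, Pi.smul_apply, smul_eq_mul]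
    ring
  exact ⟨(hf.const_mul c).congr e.symm, by rw [integral_congr_ae e, integral_const_mul]⟩

theorem InDomain.add {L lam₁ lam₂ : ℝ} {μ₁ μ₂ : ℝ → ℝ} {p q : X L}
    (hp : InDomain lam₁ lam₂ μ₁ μ₂ p) (hq : InDomain lam₁ lam₂ μ₁ μ₂ q) :
    InDomain lam₁ lam₂ μ₁ μ₂ (p + q) where
  sobolev₁ := ⟨_, hp.sobolev₁.choose_spec.add hq.sobolev₁.choose_spec⟩
  sobolev₂ := ⟨_, hp.sobolev₂.choose_spec.add hq.sobolev₂.choose_spec⟩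
  integrable₁ := (integral_add_eq _ _ _ hp.integrable₁ hq.integrable₁).1
  integrable₂ := (integral_add_eq _ _ _ hp.integrable₂ hq.integrable₂).1
  boundary₁ := by
    have h := hp.boundary₁.add hq.boundary₁
    rwa [← mul_add] at h
  boundary₂ := by
    have h := hp.boundary₂.add hq.boundary₂
    have e := (integral_add_eq (p₁ p) (p₁ q) (fun _ => 1)
      (by simpa using L1.integrable _) (by simpa using L1.integrable _)).2
    simp only [one_mul] at e
    have e' : p₁ (p + q) = p₁ p + p₁ q := rfl
    have e₂ : p₂ (p + q) = p₂ p + p₂ q := rfl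
    have e₀ : p₀ (p + q) = p₀ p + p₀ q := rfl
    rw [e', e, e₀, e₂]
    convert h using 1
    ring

theorem InDomain.smul {L lam₁ lam₂ : ℝ} {μ₁ μ₂ : ℝ → ℝ} {p : X L} (c : ℝ)
    (hp : InDomain lam₁ lam₂ μ₁ μ₂ p) : InDomain lam₁ lam₂ μ₁ μ₂ (c • p) where
  sobolev₁ := ⟨_, hp.sobolev₁.choose_spec.smul c⟩
  sobolev₂ := ⟨_, hp.sobolev₂.choose_spec.smul c⟩
  integrable₁ := (integral_smul_eq c _ _ hp.integrable₁).1
  integrable₂ := (integral_smul_eq c _ _ hp.integrable₂).1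
  boundary₁ := by
    have h := hp.boundary₁.smul c
    rwa [mul_left_comm] at h
  boundary₂ := by
    have h := hp.boundary₂.smul c
    have e := (integral_smul_eq c (p₁ p) (fun _ => 1) (by simpa using L1.integrable _)).2
    simp only [one_mul] at e
    have e' : p₁ (c • p) = c • p₁ p := rfl
    have e₂ : p₂ (c • p) = c • p₂ p := rfl
    have e₀ : p₀ (c • p) = c * p₀ p := rfl
    rw [e', e, e₀, e₂]
    convert h using 1
    ring

theorem InDomain.zero {L lam₁ lam₂ : ℝ} {μ₁ μ₂ : ℝ → ℝ} :
    InDomain lam₁ lam₂ μ₁ μ₂ (0 : X L) := by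
  have e : ∀ m : ℝ → ℝ, (fun x => m x * (0 : L1 L) x) =ᵐ[volume.restrict (Ioo 0 L)] 0 := by
    intro m
    filter_upwards [coeFn_zero_ae L] with x hx
    simp only [hx, mul_zero, zero_mul, Pi.zero_apply]
  have e1 : p₁ (0 : X L) = 0 := rfl
  have e2 : p₂ (0 : X L) = 0 := rfl
  have e0 : p₀ (0 : X L) = 0 := rfl
  have i0 := integral_congr_ae (e fun _ => 1)
  simp only [one_mul, Pi.zero_apply, integral_zero] at i0
  refine ⟨⟨0, IsWeakDeriv.zero⟩, ⟨0, IsWeakDeriv.zero⟩, (integrable_zero _ _ _).congr (e μ₁).symm,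
    (integrable_zero _ _ _).congr (e μ₂).symm, ?_, ?_⟩
  · rw [e1, e0, mul_zero]
    exact HasValueAtZero.zero
  · rw [e2, e1, e0, i0, mul_zero, add_zero]
    exact HasValueAtZero.zero

theorem IsImage.add {L lam₁ lam₂ : ℝ} {μ₁ μ₂ : ℝ → ℝ} {p q p' q' : X L}
    (hp : InDomain lam₁ lam₂ μ₁ μ₂ p) (hp' : InDomain lam₁ lam₂ μ₁ μ₂ p')
    (h : IsImage lam₁ lam₂ μ₁ μ₂ p q) (h' : IsImage lam₁ lam₂ μ₁ μ₂ p' q') :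
    IsImage lam₁ lam₂ μ₁ μ₂ (p + p') (q + q') where
  eq₀ := by
    have a := (integral_add_eq _ _ _ hp.integrable₁ hp'.integrable₁).2
    have b := (integral_add_eq _ _ _ hp.integrable₂ hp'.integrable₂).2
    change p₀ q + p₀ q' = -(lam₁ + lam₂) * (p₀ p + p₀ p')
      + (∫ x in Ioo 0 L, μ₁ x * (p₁ p + p₁ p' : L1 L) x)
      + ∫ x in Ioo 0 L, μ₂ x * (p₂ p + p₂ p' : L1 L) x
    rw [a, b, h.eq₀, h'.eq₀]
    ring
  eq₁ := by
    obtain ⟨g, hg, e⟩ := h.eq₁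
    obtain ⟨g', hg', e'⟩ := h'.eq₁
    refine ⟨g + g', hg.add hg', ?_⟩
    filter_upwards [e, e', Lp.coeFn_add g g', Lp.coeFn_add (p₁ p) (p₁ p'),
      Lp.coeFn_add (p₁ q) (p₁ q')] with x h1 h2 h3 h4 h5
    change (p₁ q + p₁ q' : L1 L) x = -((g + g' : L1 L) x + μ₁ x * (p₁ p + p₁ p' : L1 L) x
      + lam₂ * (p₁ p + p₁ p' : L1 L) x)
    rw [h3, h4, h5]
    simp only [Pi.add_apply, h1, h2]
    ring
  eq₂ := by
    obtain ⟨g, hg, e⟩ := h.eq₂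
    obtain ⟨g', hg', e'⟩ := h'.eq₂
    refine ⟨g + g', hg.add hg', ?_⟩
    filter_upwards [e, e', Lp.coeFn_add g g', Lp.coeFn_add (p₂ p) (p₂ p'),
      Lp.coeFn_add (p₂ q) (p₂ q')] with x h1 h2 h3 h4 h5
    change (p₂ q + p₂ q' : L1 L) x = -((g + g' : L1 L) x + μ₂ x * (p₂ p + p₂ p' : L1 L) x)
    rw [h3, h4, h5]
    simp only [Pi.add_apply, h1, h2]
    ring

theorem IsImage.smul {L lam₁ lam₂ : ℝ} {μ₁ μ₂ : ℝ → ℝ} {p q : X L} (c : ℝ)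
    (hp : InDomain lam₁ lam₂ μ₁ μ₂ p) (h : IsImage lam₁ lam₂ μ₁ μ₂ p q) :
    IsImage lam₁ lam₂ μ₁ μ₂ (c • p) (c • q) where
  eq₀ := by
    have a := (integral_smul_eq c _ _ hp.integrable₁).2
    have b := (integral_smul_eq c _ _ hp.integrable₂).2
    change c * p₀ q = -(lam₁ + lam₂) * (c * p₀ p)
      + (∫ x in Ioo 0 L, μ₁ x * (c • p₁ p : L1 L) x)
      + ∫ x in Ioo 0 L, μ₂ x * (c • p₂ p : L1 L) x
    rw [a, b, h.eq₀]
    ring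
  eq₁ := by
    obtain ⟨g, hg, e⟩ := h.eq₁
    refine ⟨c • g, hg.smul c, ?_⟩
    filter_upwards [e, Lp.coeFn_smul c g, Lp.coeFn_smul c (p₁ p),
      Lp.coeFn_smul c (p₁ q)] with x h1 h3 h4 h5
    change (c • p₁ q : L1 L) x = -((c • g : L1 L) x + μ₁ x * (c • p₁ p : L1 L) x
      + lam₂ * (c • p₁ p : L1 L) x)
    rw [h3, h4, h5]
    simp only [Pi.smul_apply, smul_eq_mul, h1]
    ring
  eq₂ := by
    obtain ⟨g, hg, e⟩ := h.eq₂
    refine ⟨c • g, hg.smul c, ?_⟩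
    filter_upwards [e, Lp.coeFn_smul c g, Lp.coeFn_smul c (p₂ p),
      Lp.coeFn_smul c (p₂ q)] with x h1 h3 h4 h5
    change (c • p₂ q : L1 L) x = -((c • g : L1 L) x + μ₂ x * (c • p₂ p : L1 L) x)
    rw [h3, h4, h5]
    simp only [Pi.smul_apply, smul_eq_mul, h1]
    ring

theorem IsImage.unique {L lam₁ lam₂ : ℝ} {μ₁ μ₂ : ℝ → ℝ} {p q q' : X L}
    (h : IsImage lam₁ lam₂ μ₁ μ₂ p q) (h' : IsImage lam₁ lam₂ μ₁ μ₂ p q') : q = q' := by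
  have k₀ : p₀ q = p₀ q' := h.eq₀.trans h'.eq₀.symm
  have k₁ : p₁ q = p₁ q' := by
    obtain ⟨g, hg, e⟩ := h.eq₁
    obtain ⟨g', hg', e'⟩ := h'.eq₁
    obtain rfl := hg.unique hg'
    apply Lp.ext
    filter_upwards [e, e'] with x h1 h2
    rw [h1, h2]
  have k₂ : p₂ q = p₂ q' := by
    obtain ⟨g, hg, e⟩ := h.eq₂
    obtain ⟨g', hg', e'⟩ := h'.eq₂
    obtain rfl := hg.unique hg'
    apply Lp.ext
    filter_upwards [e, e'] with x h1 h2
    rw [h1, h2]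
  exact WithLp.ofLp_injective 1 (Prod.ext k₀ (WithLp.ofLp_injective 1 (Prod.ext k₁ k₂)))

theorem IsImage.zero {L lam₁ lam₂ : ℝ} {μ₁ μ₂ : ℝ → ℝ} :
    IsImage lam₁ lam₂ μ₁ μ₂ (0 : X L) 0 := by
  have z := coeFn_zero_ae L
  have e : ∀ m : ℝ → ℝ, ∫ x in Ioo 0 L, m x * (0 : L1 L) x = 0 := by
    intro m
    rw [integral_eq_zero_of_ae]
    filter_upwards [z] with x hx
    simp only [hx, mul_zero, zero_mul, Pi.zero_apply]
  have e1 : p₁ (0 : X L) = 0 := rfl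
  have e2 : p₂ (0 : X L) = 0 := rfl
  have e0 : p₀ (0 : X L) = 0 := rfl
  refine ⟨?_, ⟨0, IsWeakDeriv.zero, ?_⟩, ⟨0, IsWeakDeriv.zero, ?_⟩⟩
  · rw [e1, e2, e0, e, e]
    ring
  · filter_upwards [z] with x hx
    rw [e1, hx]
    simp
  · filter_upwards [z] with x hx
    rw [e2, hx]
    simp

/-- The graph `{(p, 𝒜 p) : p ∈ D(𝒜)}` of the system operator. -/
def systemGraph (L lam₁ lam₂ : ℝ) (μ₁ μ₂ : ℝ → ℝ) : Submodule ℝ (X L × X L) where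
  carrier := {z | InDomain lam₁ lam₂ μ₁ μ₂ z.1 ∧ IsImage lam₁ lam₂ μ₁ μ₂ z.1 z.2}
  add_mem' h h' := ⟨h.1.add h'.1, h.2.add h.1 h'.1 h'.2⟩
  zero_mem' := ⟨InDomain.zero, IsImage.zero⟩
  smul_mem' c _ h := ⟨h.1.smul c, h.2.smul c h.1⟩

/-- The system operator `𝒜 : D(𝒜) ⊂ X → X`. -/
noncomputable def systemOperator (L lam₁ lam₂ : ℝ) (μ₁ μ₂ : ℝ → ℝ) : X L →ₗ.[ℝ] X L :=
  (systemGraph L lam₁ lam₂ μ₁ μ₂).toLinearPMap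

/-- The system operator has the intended graph: `p ∈ D(𝒜)` and `q = 𝒜 p`. -/
theorem mem_graph_systemOperator {L lam₁ lam₂ : ℝ} {μ₁ μ₂ : ℝ → ℝ} (p q : X L) :
    (p, q) ∈ (systemOperator L lam₁ lam₂ μ₁ μ₂).graph ↔
      InDomain lam₁ lam₂ μ₁ μ₂ p ∧ IsImage lam₁ lam₂ μ₁ μ₂ p q := by
  unfold systemOperator
  rw [Submodule.toLinearPMap_graph_eq]
  · rfl
  · rintro ⟨x, y⟩ ⟨_, h⟩ rfl
    exact h.unique IsImage.zero

/-- The system operator has the intended domain. -/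
theorem mem_domain_systemOperator {L lam₁ lam₂ : ℝ} {μ₁ μ₂ : ℝ → ℝ} (p : X L) :
    p ∈ (systemOperator L lam₁ lam₂ μ₁ μ₂).domain ↔ InDomain lam₁ lam₂ μ₁ μ₂ p := by
  refine ⟨fun h => ((mem_graph_systemOperator _ _).1 (LinearPMap.mem_graph _ ⟨p, h⟩)).1,
    fun h => ?_⟩
  obtain ⟨g₁, hg₁⟩ := h.sobolev₁
  obtain ⟨g₂, hg₂⟩ := h.sobolev₂
  have i₁ : Integrable (fun x => -(g₁ x + μ₁ x * p₁ p x + lam₂ * p₁ p x))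
      (volume.restrict (Ioo 0 L)) :=
    (((L1.integrable g₁).add h.integrable₁).add ((L1.integrable (p₁ p)).const_mul lam₂)).neg
  have i₂ : Integrable (fun x => -(g₂ x + μ₂ x * p₂ p x)) (volume.restrict (Ioo 0 L)) :=
    ((L1.integrable g₂).add h.integrable₂).neg
  have hq : IsImage lam₁ lam₂ μ₁ μ₂ p (WithLp.toLp 1
      (-(lam₁ + lam₂) * p₀ p + (∫ x in Ioo 0 L, μ₁ x * p₁ p x) + ∫ x in Ioo 0 L, μ₂ x * p₂ p x,
        WithLp.toLp 1 (i₁.toL1 _, i₂.toL1 _))) :=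
    ⟨rfl, ⟨g₁, hg₁, i₁.coeFn_toL1⟩, ⟨g₂, hg₂, i₂.coeFn_toL1⟩⟩
  exact LinearPMap.mem_domain_of_mem_graph ((mem_graph_systemOperator _ _).2 ⟨h, hq⟩)

end RepairableSystem

namespace RepairableSystem

/-! ### Yosida approximations of an operator with contractive resolvent -/

section HilleYosida

variable {E : Type*} [NormedAddCommGroup E] [NormedSpace ℝ E]

/-! The operator describes the probabilities of a repairable system, so it conserves total mass and
respects positivity. These two facts give a positive resolvent with `‖R γ‖ ≤ 1 / γ` for every `γ >
0`, and the Hille–Yosida theorem does the rest.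

Resolvent. For fixed `γ`, the equation `γ p - 𝒜 p = q` is a pair of scalar linear transport
equations `f' = q - (k + μ) f`, `f(0) = c`, coupled through the boundary values and the equation for
`p₀`. Each is solved by variation of constants (`exists_transport`). Since `μ` has infinite integral
while `μ f` is integrable, `f` must vanish at `L` (`integral_weakDeriv_eq`), so integrating the
equation yields an exact mass balance (`SolvesTransport.balance`). Writing each component as a
multiple of a fundamental solution plus a particular one reduces the system to a single scalar
equation `a z = b` for `z = p₀`. The balance shows `a > 0` (`characteristic_pos`), which gives
existence, uniqueness and positivity. Adding the balances gives `‖R q‖ = ‖q‖ / γ` for `q ≥ 0`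
(`mass_resolvent`); the norm is additive on the cone, so splitting into positive and negative parts
extends the bound to all `q` (`exists_resolvent`). The domain is dense because smooth functions
vanishing near `L` can be given any value at `0` at small `L¹` cost (`exists_cutoff`).

Semigroup. With `A_a = a² R_a - a`, the contractions `exp(t A_a)` converge strongly
(`cauchySeq_yosidaExp`) to a contraction semigroup generated by `A`. As `exp(t A_a)` is, up to the
factor `exp(-t a)`, a power series in `R_a` with nonnegative coefficients, positivity passes from
the resolvent to the semigroup (`yosidaLimit_mem`). Uniqueness of mild solutions follows by
comparing the integral of a solution with the Yosida flow (`eq_zero_of_integral_mem_graph`), and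
classical solutions are mild. -/

theorem norm_exp_le_exp_norm {𝔸 : Type*} [NormedRing 𝔸] [NormOneClass 𝔸] [NormedAlgebra ℝ 𝔸]
    [CompleteSpace 𝔸] (B : 𝔸) : ‖NormedSpace.exp B‖ ≤ Real.exp ‖B‖ := by
  have h1 := NormedSpace.exp_series_hasSum_exp' (𝕂 := ℝ) B
  have h2 := NormedSpace.exp_series_hasSum_exp' (𝕂 := ℝ) ‖B‖
  rw [← Real.exp_eq_exp_ℝ] at h2
  refine h1.norm_le_of_bounded h2 fun n => ?_
  rw [norm_smul, Real.norm_of_nonneg (by positivity), smul_eq_mul]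
  gcongr
  exact norm_pow_le B n

/-- `R a = (a - A)⁻¹` for all `a > 0`, with `‖R a‖ ≤ 1 / a`. -/
structure IsContractiveResolvent (A : E →ₗ.[ℝ] E) (R : ℝ → E →L[ℝ] E) : Prop where
  norm_le : ∀ a : ℝ, 0 < a → ‖R a‖ ≤ a⁻¹
  mem_graph_iff : ∀ a : ℝ, 0 < a → ∀ x y : E, (x, y) ∈ A.graph ↔ R a (a • x - y) = x

/-- The Yosida approximation `a² R a - a` of the operator with resolvent `R`. -/
noncomputable def yosida (R : ℝ → E →L[ℝ] E) (a : ℝ) : E →L[ℝ] E := (a * a) • R a - a • 1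

/-- The semigroup generated by the Yosida approximation. -/
noncomputable def yosidaExp (R : ℝ → E →L[ℝ] E) (a t : ℝ) : E →L[ℝ] E :=
  NormedSpace.exp (t • yosida R a)

namespace IsContractiveResolvent

variable {A : E →ₗ.[ℝ] E} {R : ℝ → E →L[ℝ] E} (h : IsContractiveResolvent A R)
include h

theorem map_mem_graph {a : ℝ} (ha : 0 < a) (x : E) : (R a x, a • R a x - x) ∈ A.graph := by
  rw [h.mem_graph_iff a ha, sub_sub_cancel]

theorem apply_eq {a : ℝ} (ha : 0 < a) {x y : E} (hx : (x, y) ∈ A.graph) :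
    R a (a • x - y) = x := (h.mem_graph_iff a ha x y).1 hx

theorem norm_apply_le {a : ℝ} (ha : 0 < a) (x : E) : ‖R a x‖ ≤ a⁻¹ * ‖x‖ :=
  (R a).le_of_opNorm_le (h.norm_le a ha) x

theorem norm_smul_apply_le {a : ℝ} (ha : 0 < a) (x : E) : ‖a • R a x‖ ≤ ‖x‖ := by
  rw [norm_smul, Real.norm_of_nonneg ha.le]
  calc a * ‖R a x‖ ≤ a * (a⁻¹ * ‖x‖) := by gcongr; exact h.norm_apply_le ha x
    _ = ‖x‖ := by field_simp

theorem resolvent_identity {a b : ℝ} (ha : 0 < a) (hb : 0 < b) (x : E) :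
    R b x = R a x + (a - b) • R a (R b x) := by
  have := h.apply_eq ha (h.map_mem_graph hb x)
  rw [show a • R b x - (b • R b x - x) = (a - b) • R b x + x by module, map_add, map_smul] at this
  rw [add_comm]
  exact this.symm

/-- Substituting the resolvent identity into the one with `a` and `b` exchanged leaves `(a - b)(R_a
R_b - R_b R_a) = 0`. -/
theorem commute {a b : ℝ} (ha : 0 < a) (hb : 0 < b) : Commute (R a) (R b) := by
  rcases eq_or_ne a b with rfl | hab
  · exact Commute.refl _
  ext x
  have h1 := h.resolvent_identity ha hb x
  have h2 := h.resolvent_identity hb ha x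
  have h3 : (a - b) • (R a (R b x) - R b (R a x)) = 0 := by
    have : R b x = R b x + (b - a) • R b (R a x) + (a - b) • R a (R b x) := by
      rw [← h2]; exact h1
    have h4 : (b - a) • R b (R a x) + (a - b) • R a (R b x) = 0 := by
      rw [add_assoc] at this
      exact (left_eq_add.1 this)
    rw [← h4]; module
  have := (smul_eq_zero.1 h3).resolve_left (sub_ne_zero.2 hab)
  exact sub_eq_zero.1 this

/-- If `R a x = 0`, the graph contains `(0, -x)`, and the graph of a linear operator has only `0`
above `0`. -/
theorem resolvent_injective {a : ℝ} (ha : 0 < a) : Function.Injective (R a) := by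
  refine (injective_iff_map_eq_zero _).2 fun x hx => ?_
  have h1 := h.map_mem_graph ha x
  rw [hx, smul_zero, zero_sub] at h1
  have := A.graph_fst_eq_zero_snd h1 rfl
  exact neg_eq_zero.1 this

/-- On the domain the approximation is `a R_a A`: bounded by `‖A x‖` uniformly in `a`, and
convergent to `A x` once `a R_a → I` strongly. -/
theorem yosida_apply {a : ℝ} (ha : 0 < a) {x y : E} (hx : (x, y) ∈ A.graph) :
    yosida R a x = a • R a y := by
  have h1 := h.apply_eq ha hx
  rw [map_sub, map_smul, sub_eq_iff_eq_add] at h1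
  have : R a y = a • R a x - x := by rw [h1]; abel
  rw [this]
  simp only [yosida, sub_apply, smul_apply, one_apply_eq_self]
  module

theorem commute_yosida {a b : ℝ} (ha : 0 < a) (hb : 0 < b) : Commute (R a) (yosida R b) :=
  ((h.commute ha hb).smul_right _).sub_right ((Commute.one_right _).smul_right _)

theorem yosida_commute_yosida {a b : ℝ} (ha : 0 < a) (hb : 0 < b) :
    Commute (yosida R a) (yosida R b) :=
  ((h.commute_yosida ha hb).smul_left _).sub_left ((Commute.one_left _).smul_left _)

/-- For `z` in the domain, `a R_a z - z = R_a (A z)` is `O(1/a)`. Density and the contractivity of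
`a R_a` extend the limit to all vectors. -/
theorem tendsto_smul_apply (hd : Dense (A.domain : Set E)) (x : E) :
    Tendsto (fun a : ℝ => a • R a x) atTop (𝓝 x) := by
  rw [Metric.tendsto_atTop]
  intro ε hε
  obtain ⟨z, hz, hzx⟩ := Metric.mem_closure_iff.1 (hd x) (ε / 3) (by positivity)
  obtain ⟨y, hy⟩ := LinearPMap.mem_domain_iff.1 hz
  refine ⟨3 * ‖y‖ / ε + 1, fun a ha => ?_⟩
  have ha0 : 0 < a := lt_of_lt_of_le (by positivity) ha
  have e1 : a • R a z - z = R a y := by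
    have h1 := h.apply_eq ha0 hy
    rw [map_sub, map_smul] at h1
    exact sub_eq_iff_eq_add.2 (sub_eq_iff_eq_add'.1 h1)
  have e2 : ‖a • R a z - z‖ < ε / 3 := by
    rw [e1]
    refine (h.norm_apply_le ha0 y).trans_lt ?_
    rw [inv_mul_eq_div, div_lt_iff₀ ha0]
    have : 3 * ‖y‖ / ε < a := by linarith
    rw [div_lt_iff₀ hε] at this
    linarith
  rw [dist_eq_norm] at hzx ⊢
  calc ‖a • R a x - x‖ = ‖a • R a (x - z) + (a • R a z - z) - (x - z)‖ := by
        congr 1; rw [map_sub, smul_sub]; abel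
    _ ≤ ‖a • R a (x - z)‖ + ‖a • R a z - z‖ + ‖x - z‖ :=
        (norm_sub_le _ _).trans (by gcongr; exact norm_add_le _ _)
    _ < ε := by linarith [h.norm_smul_apply_le ha0 (x - z)]

theorem commute_yosidaExp {a b : ℝ} (ha : 0 < a) (hb : 0 < b) (t : ℝ) :
    Commute (R a) (yosidaExp R b t) := by
  let _ := NormedAlgebra.restrictScalars ℚ ℝ (E →L[ℝ] E)
  exact Commute.exp_right (((h.commute_yosida ha hb)).smul_right _)

theorem yosida_commute_yosidaExp {a b : ℝ} (ha : 0 < a) (hb : 0 < b) (t : ℝ) :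
    Commute (yosida R a) (yosidaExp R b t) := by
  let _ := NormedAlgebra.restrictScalars ℚ ℝ (E →L[ℝ] E)
  exact Commute.exp_right (((h.yosida_commute_yosida ha hb)).smul_right _)

omit h in
theorem yosidaExp_zero (a : ℝ) : yosidaExp R a 0 = 1 := by
  rw [yosidaExp, zero_smul, NormedSpace.exp_zero]

variable [CompleteSpace E]

omit h in
-- Isolating the scalar factor leaves the exponential of a nonnegative multiple of `R a` when `t ≥
-- 0`. Both contractivity and invariance of cones are read off from this form.
theorem exp_smul_sub {a t : ℝ} : yosidaExp R a t =
    Real.exp (-(t * a)) • NormedSpace.exp ((t * (a * a)) • R a) := by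
  let _ := NormedAlgebra.restrictScalars ℚ ℝ (E →L[ℝ] E)
  have : t • yosida R a = (-(t * a)) • (1 : E →L[ℝ] E) + (t * (a * a)) • R a := by
    rw [yosida, smul_sub, smul_smul, smul_smul]; module
  rw [yosidaExp, this, NormedSpace.exp_add_of_commute ((Commute.one_left _).smul_left _)]
  have e : NormedSpace.exp ((-(t * a)) • (1 : E →L[ℝ] E)) =
      Real.exp (-(t * a)) • (1 : E →L[ℝ] E) := by
    have := NormedSpace.algebraMap_exp_comm (𝕂 := ℝ) (𝔸 := E →L[ℝ] E) (-(t * a))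
    rw [← Real.exp_eq_exp_ℝ, Algebra.algebraMap_eq_smul_one, Algebra.algebraMap_eq_smul_one] at this
    exact this.symm
  rw [e, smul_mul_assoc, one_mul]

theorem norm_yosidaExp_le {a t : ℝ} (ha : 0 < a) (ht : 0 ≤ t) : ‖yosidaExp R a t‖ ≤ 1 := by
  -- The exponential bound needs `‖1‖ = 1`, which fails on the zero space.
  rcases subsingleton_or_nontrivial E with hE | hE
  · have : yosidaExp R a t = 0 := by ext x; exact Subsingleton.elim _ _
    rw [this, norm_zero]; exact zero_le_one
  rw [exp_smul_sub, norm_smul, Real.norm_of_nonneg (Real.exp_pos _).le]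
  calc _ ≤ Real.exp (-(t * a)) * Real.exp (t * a) := by
        gcongr
        refine (norm_exp_le_exp_norm _).trans (Real.exp_le_exp.2 ?_)
        rw [norm_smul, Real.norm_of_nonneg (by positivity)]
        calc _ ≤ t * (a * a) * a⁻¹ := by gcongr; exact h.norm_le a ha
          _ = t * a := by field_simp
    _ = 1 := by rw [← Real.exp_add]; simp

theorem norm_yosidaExp_apply_le {a t : ℝ} (ha : 0 < a) (ht : 0 ≤ t) (x : E) :
    ‖yosidaExp R a t x‖ ≤ ‖x‖ := by
  simpa using (yosidaExp R a t).le_of_opNorm_le (h.norm_yosidaExp_le ha ht) x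

omit h in
theorem hasDerivAt_yosidaExp (a t : ℝ) :
    HasDerivAt (fun t => yosidaExp R a t) (yosidaExp R a t * yosida R a) t :=
  hasDerivAt_exp_smul_const (yosida R a) t

omit h in
theorem hasDerivAt_yosidaExp_apply (a t : ℝ) (x : E) :
    HasDerivAt (fun t => yosidaExp R a t x) (yosidaExp R a t (yosida R a x)) t :=
  by
  simpa using (hasDerivAt_yosidaExp a t).clm_apply (hasDerivAt_const t x)

omit h in
theorem yosidaExp_add (a s t : ℝ) :
    yosidaExp R a (s + t) = yosidaExp R a s * yosidaExp R a t := by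
  let _ := NormedAlgebra.restrictScalars ℚ ℝ (E →L[ℝ] E)
  rw [yosidaExp, add_smul, NormedSpace.exp_add_of_commute]
  · rfl
  · exact ((Commute.refl _).smul_left _).smul_right _

/-- The approximating semigroups are compared through the difference of their generators. -/
theorem norm_yosidaExp_sub_le {a b t : ℝ} (ha : 0 < a) (hb : 0 < b) (ht : 0 ≤ t) (x : E) :
    ‖yosidaExp R a t x - yosidaExp R b t x‖ ≤ ‖yosida R a x - yosida R b x‖ * t := by
  -- The path `s ↦ exp(s A_a) exp((t - s) A_b) x` joins the two values being compared. Commutativity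
  -- brings its derivative to two contractions applied to `A_a x - A_b x`.
  have hder : ∀ s ∈ Icc 0 t, HasDerivWithinAt
      (fun s => yosidaExp R a s (yosidaExp R b (t - s) x))
      (yosidaExp R a s (yosidaExp R b (t - s) (yosida R a x - yosida R b x))) (Icc 0 t) s := by
    intro s _
    have h1 : HasDerivAt (fun s => yosidaExp R b (t - s) x)
        (-(yosidaExp R b (t - s) (yosida R b x))) s := by
      have := (hasDerivAt_yosidaExp_apply (R := R) b (t - s) x).scomp s
        ((hasDerivAt_id s).const_sub t)
      simpa [Function.comp_def] using this
    have h2 := (hasDerivAt_yosidaExp (R := R) a s).clm_apply h1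
    refine HasDerivAt.hasDerivWithinAt (h2.congr_deriv ?_)
    have h3 := DFunLike.congr_fun (h.yosida_commute_yosidaExp ha hb (t - s)).eq x
    simp only [mul_apply_eq_comp] at h3 ⊢
    rw [h3]
    simp only [map_neg, map_sub]
    abel
  have := norm_image_sub_le_of_norm_deriv_le_segment' hder (C := ‖yosida R a x - yosida R b x‖)
    (fun s hs => (h.norm_yosidaExp_apply_le ha hs.1 _).trans
      (h.norm_yosidaExp_apply_le hb (by linarith [hs.2]) _)) t (right_mem_Icc.2 ht)
  simpa [yosidaExp_zero] using this

end IsContractiveResolvent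

end HilleYosida

/-! ### The generated semigroup, its solutions and their uniqueness -/

section HilleYosida

variable {E : Type*} [NormedAddCommGroup E] [NormedSpace ℝ E]

/-- `T t` is the strong limit of the semigroups of the Yosida approximations; for `t < 0` it is
extended constantly. -/
def IsYosidaLimit (R : ℝ → E →L[ℝ] E) (T : ℝ → E →L[ℝ] E) : Prop :=
  ∀ (t : ℝ) (x : E), Tendsto (fun a => yosidaExp R a (max t 0) x) atTop (𝓝 (T t x))

namespace IsContractiveResolvent

variable [CompleteSpace E] {A : E →ₗ.[ℝ] E} {R : ℝ → E →L[ℝ] E} (h : IsContractiveResolvent A R)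
include h

/-- On the domain the difference of two approximations is at most `t ‖A_a z - A_b z‖`, and `A_a z =
a R_a (A z)` converges. Uniform contractivity carries this to the closure of the domain. -/
theorem cauchySeq_yosidaExp (hd : Dense (A.domain : Set E)) {t : ℝ} (ht : 0 ≤ t) (x : E) :
    CauchySeq (fun a : ℝ => yosidaExp R a t x) := by
  rw [Metric.cauchySeq_iff]
  intro ε hε
  obtain ⟨z, hz, hzx⟩ := Metric.mem_closure_iff.1 (hd x) (ε / 3) (by positivity)
  obtain ⟨y, hy⟩ := LinearPMap.mem_domain_iff.1 hz
  -- The factor `t + 1` instead of `t` keeps the denominator positive at `t = 0`.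
  obtain ⟨N, hN⟩ := Metric.cauchySeq_iff.1 (h.tendsto_smul_apply hd y).cauchySeq
    (ε / (3 * (t + 1))) (by positivity)
  refine ⟨max N 1, fun a ha b hb => ?_⟩
  have ha0 : 0 < a := lt_of_lt_of_le one_pos ((le_max_right _ _).trans ha)
  have hb0 : 0 < b := lt_of_lt_of_le one_pos ((le_max_right _ _).trans hb)
  have h1 := hN a ((le_max_left _ _).trans ha) b ((le_max_left _ _).trans hb)
  have h2 := h.norm_yosidaExp_sub_le ha0 hb0 ht z
  rw [h.yosida_apply ha0 hy, h.yosida_apply hb0 hy] at h2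
  rw [dist_eq_norm] at h1 hzx ⊢
  have h3 : ‖a • R a y - b • R b y‖ * t ≤ ε / 3 := by
    calc _ ≤ ε / (3 * (t + 1)) * (t + 1) := by gcongr; linarith
      _ = ε / 3 := by field_simp
  calc ‖yosidaExp R a t x - yosidaExp R b t x‖
      = ‖yosidaExp R a t (x - z) + (yosidaExp R a t z - yosidaExp R b t z)
          - yosidaExp R b t (x - z)‖ := by congr 1; rw [map_sub, map_sub]; abel
    _ ≤ ‖yosidaExp R a t (x - z)‖ + ‖yosidaExp R a t z - yosidaExp R b t z‖
          + ‖yosidaExp R b t (x - z)‖ := (norm_sub_le _ _).trans (by gcongr; exact norm_add_le _ _)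
    _ < ε := by
      linarith [h.norm_yosidaExp_apply_le ha0 ht (x - z), h.norm_yosidaExp_apply_le hb0 ht (x - z)]

theorem exists_yosidaLimit (hd : Dense (A.domain : Set E)) :
    ∃ T : ℝ → E →L[ℝ] E, IsYosidaLimit R T := by
  choose T hT using fun (t : ℝ) (x : E) =>
    cauchySeq_tendsto_of_complete (h.cauchySeq_yosidaExp hd (le_max_right t 0) x)
  refine ⟨fun t => LinearMap.mkContinuous
    { toFun := T t
      map_add' := fun x y => tendsto_nhds_unique (hT t (x + y)) ?_
      map_smul' := fun c x => tendsto_nhds_unique (hT t (c • x)) ?_ } 1 fun x => ?_,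
    fun t x => hT t x⟩
  · simpa using (hT t x).add (hT t y)
  · simpa using (hT t x).const_smul c
  · rw [one_mul]
    refine le_of_tendsto (hT t x).norm ?_
    filter_upwards [eventually_gt_atTop 0] with a ha
    exact h.norm_yosidaExp_apply_le ha (le_max_right t 0) x

variable {T : ℝ → E →L[ℝ] E} (hT : IsYosidaLimit R T)
include hT

omit h [CompleteSpace E] in
theorem yosidaLimit_tendsto {t : ℝ} (ht : 0 ≤ t) (x : E) :
    Tendsto (fun a => yosidaExp R a t x) atTop (𝓝 (T t x)) := by
  simpa [ht] using hT t x

theorem norm_yosidaLimit_apply_le (t : ℝ) (x : E) : ‖T t x‖ ≤ ‖x‖ := by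
  refine le_of_tendsto (hT t x).norm ?_
  filter_upwards [eventually_gt_atTop 0] with a ha
  exact h.norm_yosidaExp_apply_le ha (le_max_right t 0) x

/-- Strong convergence of contractions tolerates arguments that also vary with `a`; this serves both
the semigroup law and the passage to the limit under the integral. -/
theorem tendsto_yosidaExp_of_tendsto {t : ℝ} (ht : 0 ≤ t) {z : ℝ → E} {x : E}
    (hz : Tendsto z atTop (𝓝 x)) :
    Tendsto (fun a => yosidaExp R a t (z a)) atTop (𝓝 (T t x)) := by
  have h1 := yosidaLimit_tendsto hT ht x
  have h2 : Tendsto (fun a => yosidaExp R a t (z a - x)) atTop (𝓝 0) := by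
    rw [tendsto_zero_iff_norm_tendsto_zero]
    refine squeeze_zero' (Eventually.of_forall fun _ => norm_nonneg _) ?_
      (tendsto_iff_norm_sub_tendsto_zero.1 hz)
    filter_upwards [eventually_gt_atTop 0] with a ha
    exact h.norm_yosidaExp_apply_le ha ht _
  simpa using h2.add h1

omit h [CompleteSpace E] in
theorem yosidaLimit_zero : T 0 = ContinuousLinearMap.id ℝ E := by
  ext x
  refine tendsto_nhds_unique (yosidaLimit_tendsto hT le_rfl x) ?_
  simp [yosidaExp_zero]

theorem yosidaLimit_add {s t : ℝ} (hs : 0 ≤ s) (ht : 0 ≤ t) : T (s + t) = (T s).comp (T t) := by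
  ext x
  refine tendsto_nhds_unique (yosidaLimit_tendsto hT (add_nonneg hs ht) x) ?_
  simp only [yosidaExp_add, mul_apply_eq_comp]
  exact h.tendsto_yosidaExp_of_tendsto hT hs (yosidaLimit_tendsto hT ht x)

omit [CompleteSpace E] in
theorem resolvent_yosidaLimit {a : ℝ} (ha : 0 < a) (t : ℝ) (x : E) :
    R a (T t x) = T t (R a x) := by
  refine tendsto_nhds_unique (((R a).continuous.tendsto _).comp (hT t x)) ((hT t (R a x)).congr' ?_)
  filter_upwards [eventually_gt_atTop 0] with b hb
  exact (DFunLike.congr_fun (h.commute_yosidaExp ha hb (max t 0)).eq x).symm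

theorem norm_yosidaLimit_sub_le {x y : E} (hx : (x, y) ∈ A.graph) (s t : ℝ) :
    ‖T t x - T s x‖ ≤ ‖y‖ * ‖t - s‖ := by
  refine le_of_tendsto ((hT t x).sub (hT s x)).norm ?_
  filter_upwards [eventually_gt_atTop 0] with a ha
  have h1 := (convex_Ici (0 : ℝ)).norm_image_sub_le_of_norm_hasDerivWithin_le
    (f := fun t => yosidaExp R a t x) (C := ‖y‖)
    (fun t _ => (hasDerivAt_yosidaExp_apply (R := R) a t x).hasDerivWithinAt) (fun t ht => ?_)
    (le_max_right s 0) (le_max_right t 0)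
  · refine h1.trans ?_
    gcongr
    exact abs_max_sub_max_le_abs t s 0
  · rw [h.yosida_apply ha hx]
    exact (h.norm_yosidaExp_apply_le ha ht _).trans (h.norm_smul_apply_le ha y)

/-- Orbits starting in the domain are Lipschitz, and every orbit is a uniform limit of such orbits.
Continuity holds on the whole line thanks to the constant extension to `t < 0`. -/
theorem continuous_yosidaLimit (hd : Dense (A.domain : Set E)) (x : E) :
    Continuous fun t => T t x := by
  rw [← continuousOn_univ]
  refine continuousOn_of_uniform_approx_of_continuousOn fun u hu => ?_
  obtain ⟨ε, hε, hu⟩ := Metric.mem_uniformity_dist.1 hu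
  obtain ⟨z, hz, hzx⟩ := Metric.mem_closure_iff.1 (hd x) ε hε
  obtain ⟨y, hy⟩ := LinearPMap.mem_domain_iff.1 hz
  refine ⟨fun t => T t z, ?_, fun t _ => hu ?_⟩
  · refine (LipschitzWith.of_dist_le_mul (K := ‖y‖₊) fun t s => ?_).continuous.continuousOn
    rw [dist_eq_norm, dist_eq_norm]
    exact h.norm_yosidaLimit_sub_le hT hy s t
  · rw [dist_eq_norm, ← map_sub]
    rw [dist_eq_norm] at hzx
    exact (h.norm_yosidaLimit_apply_le hT t _).trans_lt hzx

theorem yosidaLimit_sub_eq_integral (hd : Dense (A.domain : Set E)) {x y : E}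
    (hx : (x, y) ∈ A.graph) {t : ℝ} (ht : 0 ≤ t) : T t x - x = ∫ s in (0 : ℝ)..t, T s y := by
  have h1 : Tendsto (fun a => ∫ s in (0 : ℝ)..t, yosidaExp R a s (a • R a y)) atTop
      (𝓝 (∫ s in (0 : ℝ)..t, T s y)) := by
    refine intervalIntegral.tendsto_integral_filter_of_dominated_convergence (fun _ => ‖y‖)
      (Eventually.of_forall fun a => ?_) ?_ intervalIntegrable_const ?_
    · exact (continuous_iff_continuousAt.2 fun s =>
        (hasDerivAt_yosidaExp_apply (R := R) a s _).continuousAt).aestronglyMeasurable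
    · filter_upwards [eventually_gt_atTop 0] with a ha
      refine Eventually.of_forall fun s hs => ?_
      rw [uIoc_of_le ht] at hs
      exact (h.norm_yosidaExp_apply_le ha hs.1.le _).trans (h.norm_smul_apply_le ha y)
    · refine Eventually.of_forall fun s hs => ?_
      rw [uIoc_of_le ht] at hs
      exact h.tendsto_yosidaExp_of_tendsto hT hs.1.le (h.tendsto_smul_apply hd y)
  refine tendsto_nhds_unique ((yosidaLimit_tendsto hT ht x).sub_const x) (h1.congr' ?_)
  filter_upwards [eventually_gt_atTop 0] with a ha
  have := intervalIntegral.integral_eq_sub_of_hasDerivAt (a := 0) (b := t)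
    (fun s _ => hasDerivAt_yosidaExp_apply (R := R) a s x) ?_
  · rw [h.yosida_apply ha hx] at this
    rw [this, yosidaExp_zero, one_apply_eq_self]
  · exact (continuous_iff_continuousAt.2 fun s =>
        (hasDerivAt_yosidaExp_apply (R := R) a s _).continuousAt).intervalIntegrable _ _

/-- For `x` outside the domain, the integral identity is applied to `R 1 x`, whose image under `A`
is `R 1 x - x`. Moving `R 1` out of the integral turns it into the resolvent criterion for the
graph. -/
theorem integral_yosidaLimit_mem_graph (hd : Dense (A.domain : Set E)) (x : E) {t : ℝ}
    (ht : 0 ≤ t) : (∫ s in (0 : ℝ)..t, T s x, T t x - x) ∈ A.graph := by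
  have hc := h.continuous_yosidaLimit hT hd
  have h1 := h.yosidaLimit_sub_eq_integral hT hd (h.map_mem_graph one_pos x) ht
  have h2 : ∀ s, T s ((1 : ℝ) • R 1 x - x) = R 1 (T s x) - T s x := fun s => by
    rw [one_smul, map_sub, h.resolvent_yosidaLimit hT one_pos]
  simp only [h2] at h1
  have h3 : Continuous fun s => R 1 (T s x) := (R 1).continuous.comp (hc x)
  rw [intervalIntegral.integral_sub (h3.intervalIntegrable _ _)
    ((hc x).intervalIntegrable _ _),
    ContinuousLinearMap.intervalIntegral_comp_comm _ ((hc x).intervalIntegrable _ _),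
    ← h.resolvent_yosidaLimit hT one_pos] at h1
  rw [h.mem_graph_iff 1 one_pos, one_smul, map_sub, map_sub, h1]
  abel

omit hT [CompleteSpace E] in
theorem isClosed_graph : IsClosed {z : E × E | z ∈ A.graph} := by
  have : {z : E × E | z ∈ A.graph} = {z | R 1 ((1 : ℝ) • z.1 - z.2) = z.1} := by
    ext ⟨x, y⟩; exact h.mem_graph_iff 1 one_pos x y
  rw [this]
  exact isClosed_eq (by fun_prop) (by fun_prop)

theorem isC0Semigroup (hd : Dense (A.domain : Set E)) : IsC0Semigroup T where
  map_zero := yosidaLimit_zero hT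
  map_add _ _ hs ht := h.yosidaLimit_add hT hs ht
  tendsto_zero x := by
    have := ((h.continuous_yosidaLimit hT hd x).tendsto 0).mono_left
      (nhdsWithin_le_nhds (s := Ioi 0))
    rwa [yosidaLimit_zero hT] at this

omit h hT [CompleteSpace E] in
theorem tendsto_smul_integral [CompleteSpace E] {u : ℝ → E} (hu : Continuous u) :
    Tendsto (fun t : ℝ => t⁻¹ • ∫ s in (0 : ℝ)..t, u s) (𝓝[>] 0) (𝓝 (u 0)) := by
  have := (hu.integral_hasStrictDerivAt 0 0).hasDerivAt.hasDerivWithinAt (s := Ioi 0)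
  rw [hasDerivWithinAt_iff_tendsto_slope' (by simp)] at this
  refine this.congr fun t => ?_
  simp [slope_def_module]

/-- If the difference quotients at `x` converge to `y`, then the averages `t⁻¹ ∫₀ᵗ T s x` tend to
`x` while their images under `A` are those quotients; closedness of the graph gives `(x, y)`. The
other direction differentiates the integral of `T s y` at `0`. -/
theorem isGenerator (hd : Dense (A.domain : Set E)) : IsGenerator T A := by
  have hc := h.continuous_yosidaLimit hT hd
  intro x y
  constructor
  · intro hx
    have h1 := tendsto_smul_integral (hc y)
    rw [yosidaLimit_zero hT] at h1
    refine h1.congr' ?_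
    filter_upwards [self_mem_nhdsWithin] with t ht
    rw [h.yosidaLimit_sub_eq_integral hT hd hx (le_of_lt ht)]
  · intro hy
    have h1 := tendsto_smul_integral (hc x)
    rw [yosidaLimit_zero hT] at h1
    refine h.isClosed_graph.mem_of_tendsto (h1.prodMk_nhds hy) ?_
    filter_upwards [self_mem_nhdsWithin] with t ht
    exact A.graph.smul_mem t⁻¹ (h.integral_yosidaLimit_mem_graph hT hd x (le_of_lt ht))

theorem isMildSolution (hd : Dense (A.domain : Set E)) (x : E) :
    IsMildSolution A x fun t => T t x where
  continuousOn := (h.continuous_yosidaLimit hT hd x).continuousOn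
  integral_eq _ ht := h.integral_yosidaLimit_mem_graph hT hd x ht

theorem isClassicalSolution (hd : Dense (A.domain : Set E)) {x : E} (hx : x ∈ A.domain) :
    IsClassicalSolution A x fun t => T t x := by
  have hc := h.continuous_yosidaLimit hT hd
  obtain ⟨y, hy⟩ := LinearPMap.mem_domain_iff.1 hx
  refine ⟨by simp [yosidaLimit_zero hT], fun t => T t y, (hc y).continuousOn, fun t ht => ⟨?_, ?_⟩⟩
  · have h1 : HasDerivWithinAt (fun t => x + ∫ s in (0 : ℝ)..t, T s y) (T t y) (Ici 0) t :=
      (((hc y).integral_hasStrictDerivAt 0 t).hasDerivAt.const_add x).hasDerivWithinAt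
    refine h1.congr (fun s hs => ?_) ?_
    · rw [← h.yosidaLimit_sub_eq_integral hT hd hy hs]; abel
    · rw [← h.yosidaLimit_sub_eq_integral hT hd hy ht]; abel
  · rw [h.mem_graph_iff 1 one_pos, ← map_smul, ← map_sub, h.resolvent_yosidaLimit hT one_pos,
      h.apply_eq one_pos hy]

omit hT in
/-- The only integrated solution with zero initial value is zero. -/
theorem eq_zero_of_integral_mem_graph {v : ℝ → E} (hv : ContinuousOn v (Ici 0))
    (hg : ∀ t, 0 ≤ t → (∫ s in (0 : ℝ)..t, v s, v t) ∈ A.graph) {t : ℝ} (ht : 0 ≤ t) : v t = 0 := by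
  set w : ℝ → E := fun t => ∫ s in (0 : ℝ)..t, v s with hw
  have hwd : ∀ t, 0 ≤ t → ∀ s ∈ Icc 0 t, HasDerivWithinAt w (v s) (Icc 0 t) s := by
    intro t ht s hs
    have hi : IntervalIntegrable v volume 0 s := by
      refine (hv.mono ?_).intervalIntegrable
      rw [uIcc_of_le hs.1]; exact Icc_subset_Ici_self
    have : Fact (s ∈ Icc 0 t) := ⟨hs⟩
    refine intervalIntegral.integral_hasDerivWithinAt_right hi
      (hv.mono Icc_subset_Ici_self |>.stronglyMeasurableAtFilter_nhdsWithin measurableSet_Icc s)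
      ((hv s hs.1).mono Icc_subset_Ici_self)
  obtain ⟨M, hM⟩ := isCompact_Icc.exists_bound_of_continuousOn
    (hv.mono (Icc_subset_Ici_self : Icc 0 t ⊆ Ici 0))
  -- Here `w' = v = A w`. The curve `exp((t - s) A_a) R 1 (w s)` goes from `0` to `R 1 (w t)`, and
  -- its speed is at most `‖(A - A_a) R 1 (w s)‖`. Since `v` need not lie in the domain, `R 1` is
  -- inserted: then the difference equals `-R_a (A R 1 (v s))` with `A R 1 v = R 1 v - v`, of size
  -- `2 M / a`.
  have key : ∀ a : ℝ, 0 < a → ‖R 1 (w t)‖ ≤ (a⁻¹ * (2 * M)) * t := by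
    intro a ha
    have hder : ∀ s ∈ Icc 0 t, HasDerivWithinAt
        (fun s => yosidaExp R a (t - s) (R 1 (w s)))
        (yosidaExp R a (t - s) (-(R a (R 1 (v s) - v s)))) (Icc 0 t) s := by
      intro s hs
      have h1 : HasDerivAt (fun s => yosidaExp R a (t - s))
          (-(yosidaExp R a (t - s) * yosida R a)) s := by
        have := (hasDerivAt_yosidaExp (R := R) a (t - s)).scomp s
          ((hasDerivAt_id s).const_sub t)
        simpa [Function.comp_def] using this
      have h2 := h1.hasDerivWithinAt.clm_apply
        ((R 1).hasFDerivAt.comp_hasDerivWithinAt s (hwd t ht s hs))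
      refine h2.congr_deriv ?_
      have h3 : (R 1 (w s), R 1 (v s)) ∈ A.graph := by
        rw [h.mem_graph_iff 1 one_pos, ← map_smul, ← map_sub, h.apply_eq one_pos (hg s hs.1)]
      have h4 : R a (R 1 (v s) - v s) = a • R a (R 1 (v s)) - R 1 (v s) := by
        have := h.apply_eq ha (h.map_mem_graph one_pos (v s))
        rw [one_smul, map_sub, map_smul] at this
        rw [eq_sub_iff_add_eq, ← sub_eq_iff_eq_add'.1 (Eq.trans ?_ this)]
        abel
      simp only [neg_apply, mul_apply_eq_comp, h4, Function.comp]
      rw [h.yosida_apply ha h3, ← map_neg, ← map_add]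
      congr 1
      abel
    have h5 := norm_image_sub_le_of_norm_deriv_le_segment' hder (C := a⁻¹ * (2 * M))
      (fun s hs => ?_) t (right_mem_Icc.2 ht)
    · simpa [yosidaExp_zero, hw] using h5
    · have hM' := hM s ⟨hs.1, hs.2.le⟩
      refine (h.norm_yosidaExp_apply_le ha (by linarith [hs.2]) _).trans ?_
      rw [norm_neg]
      refine (h.norm_apply_le ha _).trans ?_
      gcongr
      have := h.norm_apply_le one_pos (v s)
      rw [inv_one, one_mul] at this
      linarith [norm_sub_le (R 1 (v s)) (v s)]
  have h6 : ‖R 1 (w t)‖ ≤ 0 := by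
    have : Tendsto (fun a : ℝ => (a⁻¹ * (2 * M)) * t) atTop (𝓝 ((0 * (2 * M)) * t)) :=
      (tendsto_inv_atTop_zero.mul_const _).mul_const _
    rw [zero_mul, zero_mul] at this
    refine ge_of_tendsto this ?_
    filter_upwards [eventually_gt_atTop 0] with a ha using key a ha
  have h7 : w t = 0 := h.resolvent_injective one_pos (by rw [norm_le_zero_iff.1 h6, map_zero])
  exact A.graph_fst_eq_zero_snd (hg t ht) h7

theorem eq_of_isMildSolution (hd : Dense (A.domain : Set E)) {x : E} {u : ℝ → E}
    (hu : IsMildSolution A x u) {t : ℝ} (ht : 0 ≤ t) : u t = T t x := by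
  have hc := h.continuous_yosidaLimit hT hd x
  refine sub_eq_zero.1 (h.eq_zero_of_integral_mem_graph (v := fun t => u t - T t x)
    (hu.continuousOn.sub hc.continuousOn) (fun s hs => ?_) ht)
  have h1 := A.graph.sub_mem (hu.integral_eq s hs) (h.integral_yosidaLimit_mem_graph hT hd x hs)
  have hi : IntervalIntegrable u volume 0 s := by
    refine (hu.continuousOn.mono ?_).intervalIntegrable
    rw [uIcc_of_le hs]; exact Icc_subset_Ici_self
  rw [intervalIntegral.integral_sub hi (hc.intervalIntegrable _ _)]
  simpa using h1

omit hT in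
-- The pointwise relation `R 1 (u - u') = u` encodes `u' = A u` through a bounded operator, so it
-- can be integrated without commuting the unbounded `A` with the integral.
theorem isMildSolution_of_isClassicalSolution {x : E} {u : ℝ → E}
    (hu : IsClassicalSolution A x u) : IsMildSolution A x u := by
  obtain ⟨u', hc, hu'⟩ := hu.exists_deriv
  have hcu : ContinuousOn u (Ici 0) := fun t ht => (hu' t ht).1.continuousWithinAt
  refine ⟨hcu, fun t ht => ?_⟩
  have hsub : uIcc 0 t ⊆ Ici 0 := by rw [uIcc_of_le ht]; exact Icc_subset_Ici_self
  have hi := (hcu.mono hsub).intervalIntegrable (μ := volume)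
  have hi' := (hc.mono hsub).intervalIntegrable (μ := volume)
  have h1 : ∫ s in (0 : ℝ)..t, u' s = u t - u 0 := by
    refine intervalIntegral.integral_eq_sub_of_hasDeriv_right (hcu.mono hsub) (fun s hs => ?_) hi'
    have hs0 : 0 < s := by simpa [ht] using hs.1
    exact ((hu' s hs0.le).1.hasDerivAt (Ici_mem_nhds hs0)).hasDerivWithinAt
  rw [← hu.initial, ← h1, h.mem_graph_iff 1 one_pos, one_smul,
    ← intervalIntegral.integral_sub hi hi',
    ← ContinuousLinearMap.intervalIntegral_comp_comm _ (hi.sub hi')]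
  refine intervalIntegral.integral_congr fun s hs => ?_
  simpa using h.apply_eq one_pos (hu' s (hsub hs)).2

omit h in
-- The exponential series of `R a` has nonnegative coefficients and is scaled by `exp(-t a) > 0`, so
-- its partial sums, and then all limits, stay in the closed cone.
theorem yosidaLimit_mem (K : AddSubmonoid E) (hK : IsClosed (K : Set E))
    (hsmul : ∀ c : ℝ, 0 ≤ c → ∀ x ∈ K, c • x ∈ K) (hR : ∀ a, 0 < a → ∀ x ∈ K, R a x ∈ K)
    {x : E} (hx : x ∈ K) (t : ℝ) : T t x ∈ K := by
  refine hK.mem_of_tendsto (hT t x) ?_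
  filter_upwards [eventually_gt_atTop 0] with a ha
  rw [exp_smul_sub]
  refine hsmul _ (Real.exp_pos _).le _ ?_
  have h1 := (NormedSpace.exp_series_hasSum_exp' (𝕂 := ℝ) ((max t 0 * (a * a)) • R a)).mapL
    (ContinuousLinearMap.apply ℝ E x)
  refine hK.mem_of_tendsto h1 (Eventually.of_forall fun s => sum_mem fun n _ => ?_)
  have h2 : ∀ n : ℕ, (((max t 0 * (a * a)) • R a) ^ n) x ∈ K := by
    intro n
    induction n with
    | zero => simpa using hx
    | succ n ih =>
      rw [pow_succ']
      exact hsmul _ (by positivity) _ (hR a ha _ ih)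
  exact hsmul _ (by positivity) _ (h2 n)

end IsContractiveResolvent

end HilleYosida

/-! ### Absolutely continuous functions and primitives -/

section AbsolutelyContinuous

theorem absolutelyContinuousOnInterval_lipschitz_comp {f g : ℝ → ℝ} {a b : ℝ} {K : NNReal}
    {s : Set ℝ} (hg : LipschitzOnWith K g s) (hf : AbsolutelyContinuousOnInterval f a b)
    (hs : MapsTo f (uIcc a b) s) : AbsolutelyContinuousOnInterval (fun x => g (f x)) a b := by
  have h1 := Tendsto.const_mul (K : ℝ) hf
  rw [mul_zero] at h1
  refine squeeze_zero' (Eventually.of_forall fun _ => Finset.sum_nonneg fun _ _ => dist_nonneg)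
    ?_ h1
  rw [eventually_inf_principal]
  refine Eventually.of_forall fun E hE => ?_
  rw [Finset.mul_sum]
  exact Finset.sum_le_sum fun i hi =>
    hg.dist_le_mul _ (hs (hE.1 i hi).1) _ (hs (hE.1 i hi).2)

/-- An absolutely continuous function is bounded on the interval, and the exponential is Lipschitz
on bounded sets. This makes integrating factors available for rates that are merely integrable. -/
theorem absolutelyContinuousOnInterval_exp {f : ℝ → ℝ} {a b : ℝ}
    (hf : AbsolutelyContinuousOnInterval f a b) :
    AbsolutelyContinuousOnInterval (fun x => Real.exp (f x)) a b := by
  obtain ⟨C, hC⟩ := hf.exists_bound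
  obtain ⟨K, hK⟩ := (Real.contDiff_exp (n := 1)).contDiffOn.exists_lipschitzOnWith
    (s := Icc (-C) C) (by decide) (convex_Icc _ _) isCompact_Icc
  exact absolutelyContinuousOnInterval_lipschitz_comp hK hf fun x hx => abs_le.1 (hC x hx)

/-- The fundamental theorem of calculus for an absolutely continuous function whose derivative is
known almost everywhere. -/
theorem integral_eq_sub_of_ae_hasDerivAt {f g : ℝ → ℝ} {l : ℝ} (hl : 0 ≤ l)
    (hf : AbsolutelyContinuousOnInterval f 0 l)
    (hfg : ∀ᵐ x, x ∈ Ioo 0 l → HasDerivAt f (g x) x) : ∫ x in (0 : ℝ)..l, g x = f l - f 0 := by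
  rw [← hf.integral_deriv_eq_sub]
  refine intervalIntegral.integral_congr_ae ?_
  have h2 : ∀ᵐ x : ℝ, x ≠ l := by simp [ae_iff, measure_singleton]
  filter_upwards [hfg, h2] with x h1 h2 h3
  rw [uIoc_of_le hl] at h3
  exact (h1 ⟨h3.1, lt_of_le_of_ne h3.2 h2⟩).deriv.symm

theorem intervalIntegrable_of_integrableOn_Ioo {g : ℝ → ℝ} {l : ℝ} (hl : 0 ≤ l)
    (hg : IntegrableOn g (Ioo 0 l)) : IntervalIntegrable g volume 0 l := by
  rwa [intervalIntegrable_iff_integrableOn_Ioo_of_le hl]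

theorem absolutelyContinuousOnInterval_primitive {g : ℝ → ℝ} {l : ℝ} (hl : 0 ≤ l)
    (hg : IntegrableOn g (Ioo 0 l)) (c : ℝ) :
    AbsolutelyContinuousOnInterval (fun x => c + ∫ s in (0 : ℝ)..x, g s) 0 l :=
  ((LipschitzWith.const c).lipschitzOnWith.absolutelyContinuousOnInterval).add
    ((intervalIntegrable_of_integrableOn_Ioo hl hg).absolutelyContinuousOnInterval_intervalIntegral
      left_mem_uIcc)

theorem ae_hasDerivAt_primitive {g : ℝ → ℝ} {l : ℝ} (hl : 0 ≤ l)
    (hg : IntegrableOn g (Ioo 0 l)) (c : ℝ) :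
    ∀ᵐ x, x ∈ Ioo 0 l → HasDerivAt (fun x => c + ∫ s in (0 : ℝ)..x, g s) (g x) x := by
  filter_upwards [(intervalIntegrable_of_integrableOn_Ioo hl hg).ae_hasDerivAt_integral] with x h1 hx
  rw [uIcc_of_le hl] at h1
  exact (h1 (Ioo_subset_Icc_self hx) 0 (left_mem_Icc.2 hl)).const_add c

theorem continuousOn_primitive_Icc {g : ℝ → ℝ} {l : ℝ} (hl : 0 ≤ l)
    (hg : IntegrableOn g (Ioo 0 l)) (c : ℝ) :
    ContinuousOn (fun x => c + ∫ s in (0 : ℝ)..x, g s) (Icc 0 l) := by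
  have := (absolutelyContinuousOnInterval_primitive hl hg c).continuousOn
  rwa [uIcc_of_le hl] at this

end AbsolutelyContinuous

/-! ### Weak derivatives and continuous representatives -/

section WeakDerivative

variable {L : ℝ}

/-- The primitive of an integrable function has that function as its weak derivative. -/
theorem integral_primitive_mul_deriv (hL : 0 < L) {g : ℝ → ℝ} (hg : IntegrableOn g (Ioo 0 L))
    (c : ℝ) {φ : ℝ → ℝ} (h1 : ContDiff ℝ ∞ φ) (h3 : tsupport φ ⊆ Ioo 0 L) :
    ∫ x in Ioo 0 L, (c + ∫ s in (0 : ℝ)..x, g s) * deriv φ x = -∫ x in Ioo 0 L, g x * φ x := by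
  have hφ : ∀ x, x ∉ Ioo 0 L → φ x = 0 := fun x hx =>
    image_eq_zero_of_notMem_tsupport fun hn => hx (h3 hn)
  have hφ' : AbsolutelyContinuousOnInterval φ 0 L :=
    (h1.of_le (by exact_mod_cast le_top)).contDiffOn.absolutelyContinuousOnInterval
  have h := (absolutelyContinuousOnInterval_primitive hL.le hg c).integral_mul_deriv_eq_deriv_mul
    hφ'
  rw [hφ 0 (by simp), hφ L (by simp), mul_zero, mul_zero, sub_zero, zero_sub,
    intervalIntegral.integral_of_le hL.le, intervalIntegral.integral_of_le hL.le,
    integral_Ioc_eq_integral_Ioo, integral_Ioc_eq_integral_Ioo] at h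
  rw [h]
  congr 1
  refine integral_congr_ae ((ae_restrict_iff' measurableSet_Ioo).2 ?_)
  filter_upwards [ae_hasDerivAt_primitive hL.le hg c] with x h4 h5
  rw [(h4 h5).deriv]

theorem isWeakDeriv_of_primitive (hL : 0 < L) {f g : L1 L} {c : ℝ}
    (hf : f =ᵐ[volume.restrict (Ioo 0 L)] fun x => c + ∫ s in (0 : ℝ)..x, g s) :
    IsWeakDeriv f g := by
  intro φ h1 _ h3
  rw [← integral_primitive_mul_deriv hL (L1.integrable g) c h1 h3]
  refine integral_congr_ae ?_
  filter_upwards [hf] with x hx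
  rw [hx]

theorem exists_Icc_of_isCompact_subset_Ioo {K : Set ℝ} (hK : IsCompact K) {a b : ℝ} (hab : a < b)
    (h : K ⊆ Ioo a b) : ∃ a' b', a < a' ∧ b' < b ∧ K ⊆ Icc a' b' := by
  rcases K.eq_empty_or_nonempty with rfl | hne
  · exact ⟨b, a, hab, hab, empty_subset _⟩
  · exact ⟨sInf K, sSup K, (h (hK.sInf_mem hne)).1, (h (hK.sSup_mem hne)).2,
      fun x hx => ⟨csInf_le hK.bddBelow hx, le_csSup hK.bddAbove hx⟩⟩

/-- A test function with vanishing integral is the derivative of a test function. -/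
theorem exists_primitive_of_integral_eq_zero (hL : 0 < L) {χ : ℝ → ℝ} (h1 : ContDiff ℝ ∞ χ)
    (h2 : HasCompactSupport χ) (h3 : tsupport χ ⊆ Ioo 0 L) (h0 : ∫ x, χ x = 0) :
    ∃ Φ : ℝ → ℝ, ContDiff ℝ ∞ Φ ∧ HasCompactSupport Φ ∧ tsupport Φ ⊆ Ioo 0 L ∧ deriv Φ = χ := by
  obtain ⟨a, b, ha, hb, hab⟩ := exists_Icc_of_isCompact_subset_Ioo h2 hL h3
  have hz : ∀ x, x ∉ Icc a b → χ x = 0 := fun x hx =>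
    image_eq_zero_of_notMem_tsupport fun hn => hx (hab hn)
  have hder : ∀ x, HasDerivAt (fun x => ∫ s in (0 : ℝ)..x, χ s) (χ x) x := fun x =>
    (h1.continuous.integral_hasStrictDerivAt 0 x).hasDerivAt
  have hd : deriv (fun x => ∫ s in (0 : ℝ)..x, χ s) = χ := funext fun x => (hder x).deriv
  have hsupp : Function.support (fun x => ∫ s in (0 : ℝ)..x, χ s) ⊆ Icc a b := by
    intro x hx
    by_contra hn
    refine hx ?_
    rcases lt_or_ge x a with hxa | hxa
    · refine intervalIntegral.integral_zero_ae (Eventually.of_forall fun s hs => hz s fun hs' => ?_)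
      rcases le_total 0 x with h | h
      · rw [uIoc_of_le h] at hs; linarith [hs.2, hs'.1]
      · rw [uIoc_of_ge h] at hs; linarith [hs.2, hs'.1]
    · have hxb : b < x := by
        by_contra hh; exact hn ⟨hxa, not_lt.1 hh⟩
      change ∫ s in (0 : ℝ)..x, χ s = 0
      rw [intervalIntegral.integral_of_le (ha.le.trans hxa)]
      refine Eq.trans ?_ h0
      refine setIntegral_eq_integral_of_forall_compl_eq_zero fun s hs => hz s fun hs' => hs ?_
      exact ⟨ha.trans_le hs'.1, hs'.2.trans hxb.le⟩
  have hts := closure_minimal hsupp isClosed_Icc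
  refine ⟨_, ?_, HasCompactSupport.of_support_subset_isCompact isCompact_Icc hsupp,
    hts.trans fun x hx => ⟨ha.trans_le hx.1, hx.2.trans_lt hb⟩, hd⟩
  rw [contDiff_infty_iff_deriv, hd]
  exact ⟨fun x => (hder x).differentiableAt, h1⟩

theorem integral_eq_setIntegral_of_tsupport_subset {φ : ℝ → ℝ} (h : tsupport φ ⊆ Ioo 0 L) :
    ∫ x in Ioo 0 L, φ x = ∫ x, φ x :=
  setIntegral_eq_integral_of_forall_compl_eq_zero fun _ hx =>
    image_eq_zero_of_notMem_tsupport fun hn => hx (h hn)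

/-- The lemma of du Bois-Reymond for continuous functions. -/
theorem eq_const_of_integral_mul_deriv_eq_zero (hL : 0 < L) {w : ℝ → ℝ}
    (hw : ContinuousOn w (Icc 0 L))
    (h : ∀ φ : ℝ → ℝ, ContDiff ℝ ∞ φ → HasCompactSupport φ → tsupport φ ⊆ Ioo 0 L →
      ∫ x in Ioo 0 L, w x * deriv φ x = 0) {x : ℝ} (hx : x ∈ Icc 0 L) : w x = w 0 := by
  have hwi : IntegrableOn w (Ioo 0 L) := hw.integrableOn_Icc.mono_set Ioo_subset_Icc_self
  have hi : ∀ {φ : ℝ → ℝ}, ContDiff ℝ ∞ φ → HasCompactSupport φ →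
      IntegrableOn (fun x => w x * φ x) (Ioo 0 L) := fun {φ} h1 h2 => by
    obtain ⟨C, hC⟩ := h1.continuous.bounded_above_of_compact_support h2
    exact hwi.mul_bdd (c := C) h1.continuous.aestronglyMeasurable (Eventually.of_forall hC)
  let B : ContDiffBump (L / 2) := ⟨L / 8, L / 4, by positivity, by linarith⟩
  set β : ℝ → ℝ := B.normed volume with hβ
  have b1 : ContDiff ℝ ∞ β := B.contDiff_normed
  have b2 : HasCompactSupport β := B.hasCompactSupport_normed
  have b3 : tsupport β ⊆ Ioo 0 L := by
    rw [hβ, B.tsupport_normed_eq, Real.closedBall_eq_Icc]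
    intro x hx
    have e : B.rOut = L / 4 := rfl
    rw [e] at hx
    exact ⟨by linarith [hx.1], by linarith [hx.2]⟩
  have b4 : ∫ x, β x = 1 := B.integral_normed
  set k : ℝ := ∫ x in Ioo 0 L, w x * β x with hk
  have key : ∀ᵐ x, x ∈ Ioo 0 L → w x - k = 0 := by
    refine isOpen_Ioo.ae_eq_zero_of_integral_contDiff_smul_eq_zero
      (hwi.sub (integrable_const k)).locallyIntegrableOn fun ψ h1 h2 h3 => ?_
    -- As `β` has integral one, this correction of `ψ` has integral zero and is the derivative of a
    -- test function. Testing `w` against it gives `∫ w ψ = k ∫ ψ`.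
    have hχ1 : ContDiff ℝ ∞ (fun x => ψ x - (∫ y, ψ y) * β x) := h1.sub (contDiff_const.mul b1)
    have hχ2 : HasCompactSupport (fun x => ψ x - (∫ y, ψ y) * β x) := h2.sub b2.mul_left
    have hχ3 : tsupport (fun x => ψ x - (∫ y, ψ y) * β x) ⊆ Ioo 0 L :=
      (tsupport_sub _ _).trans (union_subset h3 ((tsupport_mul_subset_right).trans b3))
    have hψi := h1.continuous.integrable_of_hasCompactSupport h2 (μ := volume)
    have hβi := b1.continuous.integrable_of_hasCompactSupport b2 (μ := volume)
    obtain ⟨Φ, p1, p2, p3, p4⟩ := exists_primitive_of_integral_eq_zero hL hχ1 hχ2 hχ3 (by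
      rw [integral_sub hψi (hβi.const_mul _), integral_const_mul, b4, mul_one, sub_self])
    have h4 := h Φ p1 p2 p3
    rw [p4] at h4
    have h5 : ∫ x in Ioo 0 L, w x * (ψ x - (∫ y, ψ y) * β x) =
        (∫ x in Ioo 0 L, w x * ψ x) - (∫ y, ψ y) * k := by
      rw [hk, ← integral_const_mul, ← integral_sub (hi h1 h2) ((hi b1 b2).const_mul _)]
      congr 1; ext x; ring
    have hz : ∀ x, x ∉ Ioo 0 L → ψ x • (w x - k) = 0 := fun x hx => by
      rw [image_eq_zero_of_notMem_tsupport (fun hn => hx (h3 hn)), zero_smul]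
    rw [← setIntegral_eq_integral_of_forall_compl_eq_zero hz]
    have h6 : ∫ x in Ioo 0 L, ψ x • (w x - k) =
        (∫ x in Ioo 0 L, w x * ψ x) - (∫ x in Ioo 0 L, ψ x) * k := by
      rw [← integral_mul_const, ← integral_sub (hi h1 h2) (hψi.integrableOn.mul_const _)]
      congr 1; ext x; simp only [smul_eq_mul]; ring
    rw [h6, integral_eq_setIntegral_of_tsupport_subset h3, ← h5, h4]
  have hEq : EqOn w (fun _ => k) (Icc 0 L) := by
    refine Measure.eqOn_Icc_of_ae_eq volume hL.ne ?_ hw continuousOn_const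
    rw [← restrict_Ioo_eq_restrict_Icc]
    refine (ae_restrict_iff' measurableSet_Ioo).2 ?_
    filter_upwards [key] with x h1 h2 using sub_eq_zero.1 (h1 h2)
  rw [hEq hx, hEq (left_mem_Icc.2 hL.le)]

/-- The continuous representative of a weakly differentiable function is the primitive of the weak
derivative. -/
theorem IsWeakDeriv.eq_primitive (hL : 0 < L) {f g : L1 L} (hfg : IsWeakDeriv f g) {u : ℝ → ℝ}
    (hu : ContinuousOn u (Icc 0 L)) (hfu : f =ᵐ[volume.restrict (Ioo 0 L)] u) {x : ℝ}
    (hx : x ∈ Icc 0 L) : u x = u 0 + ∫ s in (0 : ℝ)..x, g s := by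
  have hc := continuousOn_primitive_Icc hL.le (L1.integrable g) 0
  have hui : IntegrableOn u (Ioo 0 L) := hu.integrableOn_Icc.mono_set Ioo_subset_Icc_self
  have hpi := hc.integrableOn_Icc (μ := volume) |>.mono_set Ioo_subset_Icc_self
  have h := eq_const_of_integral_mul_deriv_eq_zero hL (hu.sub hc) (fun φ h1 h2 h3 => ?_) hx
  · simp only [Pi.sub_apply, zero_add, intervalIntegral.integral_same, sub_zero] at h
    linarith
  · have hd : Continuous (deriv φ) := h1.continuous_deriv (by simp)
    obtain ⟨C, hC⟩ := hd.bounded_above_of_compact_support h2.deriv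
    have hb := Eventually.of_forall (f := ae (volume.restrict (Ioo 0 L))) hC
    have e : ∫ x in Ioo 0 L, u x * deriv φ x = ∫ x in Ioo 0 L, f x * deriv φ x := by
      refine integral_congr_ae ?_
      filter_upwards [hfu] with x hx
      rw [hx]
    simp only [Pi.sub_apply, sub_mul]
    rw [integral_sub (hui.mul_bdd hd.aestronglyMeasurable hb)
      (hpi.mul_bdd hd.aestronglyMeasurable hb), e, hfg φ h1 h2 h3,
      integral_primitive_mul_deriv hL (L1.integrable g) 0 h1 h3, sub_self]

theorem IsWeakDeriv.ae_eq_primitive (hL : 0 < L) {f g : L1 L} (hfg : IsWeakDeriv f g) {c : ℝ}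
    (hc : HasValueAtZero f c) :
    f =ᵐ[volume.restrict (Ioo 0 L)] fun x => c + ∫ s in (0 : ℝ)..x, g s := by
  obtain ⟨u, hu, hfu, rfl⟩ := hc
  filter_upwards [hfu, ae_restrict_mem measurableSet_Ioo] with x h1 h2
  rw [h1, hfg.eq_primitive hL hu hfu (Ioo_subset_Icc_self h2)]

end WeakDerivative

/-! ### The scalar transport equation with repair rate -/

section Transport

variable {L k c : ℝ} {N : ℕ} {μ q : ℝ → ℝ}

theorem IsRepairRate.integrableOn_of_lt (hμ : IsRepairRate L N μ) {l : ℝ} (hl : l < L) :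
    IntegrableOn μ (Ioo 0 l) := by
  rcases le_or_gt l 0 with h | h
  · simp [Ioo_eq_empty_of_le h]
  · exact hμ.integrableOn l h hl

theorem IsRepairRate.integrableOn_const_add (hμ : IsRepairRate L N μ) (k : ℝ) {l : ℝ} (hl : l < L) :
    IntegrableOn (fun x => k + μ x) (Ioo 0 l) :=
  (integrable_const k).add (hμ.integrableOn_of_lt hl)

/-- Measurability up to `L` comes from local integrability on the open interval, although `μ` is not
integrable there. -/
theorem IsRepairRate.aestronglyMeasurable (hμ : IsRepairRate L N μ) :
    AEStronglyMeasurable μ (volume.restrict (Ioo 0 L)) := by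
  have : LocallyIntegrableOn μ (Ioo 0 L) := fun x hx =>
    ⟨Ioo 0 ((x + L) / 2), mem_nhdsWithin_of_mem_nhds
      (Ioo_mem_nhds hx.1 (by linarith [hx.2])), hμ.integrableOn_of_lt (by linarith [hx.2])⟩
  exact this.aestronglyMeasurable

/-- The cumulative hazard of the rate `k + μ`. -/
noncomputable def hazard (k : ℝ) (μ : ℝ → ℝ) (x : ℝ) : ℝ := ∫ s in (0 : ℝ)..x, (k + μ s)

/-- The solution of `u' = q - (k + μ) u`, `u 0 = c`, by variation of constants. -/
noncomputable def transportSol (k : ℝ) (μ : ℝ → ℝ) (c : ℝ) (q : ℝ → ℝ) (x : ℝ) : ℝ :=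
  Real.exp (-hazard k μ x) * (c + ∫ s in (0 : ℝ)..x, Real.exp (hazard k μ s) * q s)

theorem transportSol_zero : transportSol k μ c q 0 = c := by
  simp [transportSol, hazard]

theorem hazard_eq (k : ℝ) (μ : ℝ → ℝ) :
    hazard k μ = fun x => 0 + ∫ s in (0 : ℝ)..x, (k + μ s) := by
  ext x; rw [hazard, zero_add]

theorem absolutelyContinuousOnInterval_hazard (hμ : IsRepairRate L N μ) (k : ℝ) {l : ℝ}
    (h0 : 0 ≤ l) (hl : l < L) : AbsolutelyContinuousOnInterval (hazard k μ) 0 l := by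
  rw [hazard_eq]
  exact absolutelyContinuousOnInterval_primitive h0 (hμ.integrableOn_const_add k hl) 0

theorem ae_hasDerivAt_hazard (hμ : IsRepairRate L N μ) (k : ℝ) {l : ℝ}
    (h0 : 0 ≤ l) (hl : l < L) : ∀ᵐ x, x ∈ Ioo 0 l → HasDerivAt (hazard k μ) (k + μ x) x := by
  rw [hazard_eq]
  exact ae_hasDerivAt_primitive h0 (hμ.integrableOn_const_add k hl) 0

theorem integrableOn_exp_hazard_mul (hμ : IsRepairRate L N μ) (hq : IntegrableOn q (Ioo 0 L))
    {l : ℝ} (h0 : 0 ≤ l) (hl : l < L) :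
    IntegrableOn (fun x => Real.exp (hazard k μ x) * q x) (Ioo 0 l) := by
  rw [← intervalIntegrable_iff_integrableOn_Ioo_of_le h0]
  exact (intervalIntegrable_of_integrableOn_Ioo h0
    (hq.mono_set (Ioo_subset_Ioo_right hl.le))).continuousOn_mul
    (absolutelyContinuousOnInterval_exp
      (absolutelyContinuousOnInterval_hazard hμ k h0 hl)).continuousOn

theorem absolutelyContinuousOnInterval_transportSol (hμ : IsRepairRate L N μ)
    (hq : IntegrableOn q (Ioo 0 L)) {l : ℝ} (h0 : 0 ≤ l) (hl : l < L) :
    AbsolutelyContinuousOnInterval (transportSol k μ c q) 0 l :=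
  (absolutelyContinuousOnInterval_exp (absolutelyContinuousOnInterval_hazard hμ k h0 hl).neg).mul
    (absolutelyContinuousOnInterval_primitive h0 (integrableOn_exp_hazard_mul hμ hq h0 hl) c)

/-- The product rule holds almost everywhere, and absolute continuity on `[0, l]` allows integrating
it. This integrated form yields both the a priori bound and the weak derivative. -/
theorem transportSol_eq (hμ : IsRepairRate L N μ)
    (hq : IntegrableOn q (Ioo 0 L)) {l : ℝ} (h0 : 0 ≤ l) (hl : l < L) :
    transportSol k μ c q l = c + ∫ s in (0 : ℝ)..l, (q s - (k + μ s) * transportSol k μ c q s) := by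
  rw [integral_eq_sub_of_ae_hasDerivAt h0
    (absolutelyContinuousOnInterval_transportSol (k := k) (c := c) hμ hq h0 hl) ?_,
    transportSol_zero]
  · ring
  filter_upwards [ae_hasDerivAt_hazard hμ k h0 hl,
    ae_hasDerivAt_primitive h0 (integrableOn_exp_hazard_mul (k := k) hμ hq h0 hl) c] with x h1 h2 hx
  refine ((h1 hx).neg.exp.mul (h2 hx)).congr_deriv ?_
  have : Real.exp (-hazard k μ x) * (Real.exp (hazard k μ x) * q x) = q x := by
    rw [← mul_assoc, ← Real.exp_add]; simp
  rw [Pi.neg_apply, this, transportSol]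
  ring

theorem continuousOn_transportSol (hμ : IsRepairRate L N μ) (hq : IntegrableOn q (Ioo 0 L)) :
    ContinuousOn (transportSol k μ c q) (Ioo 0 L) := by
  intro x hx
  have h0 : 0 ≤ (x + L) / 2 := by linarith [hx.1, hx.2]
  have h1 := (absolutelyContinuousOnInterval_transportSol (k := k) (c := c) hμ hq h0
    (by linarith [hx.2])).continuousOn
  rw [uIcc_of_le h0] at h1
  exact (h1.continuousAt (Icc_mem_nhds hx.1 (by linarith [hx.2]))).continuousWithinAt

theorem abs_transportSol_le {x : ℝ} (hx : x ∈ Ioo 0 L) :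
    |transportSol k μ c q x| ≤ transportSol k μ |c| (fun x => |q x|) x := by
  rw [transportSol, transportSol, abs_mul, abs_of_pos (Real.exp_pos _)]
  gcongr
  refine (abs_add_le _ _).trans ?_
  gcongr
  refine (intervalIntegral.abs_integral_le_integral_abs hx.1.le).trans (le_of_eq ?_)
  simp only [abs_mul, Real.abs_exp]

theorem transportSol_nonneg (hc : 0 ≤ c) {x : ℝ} (hx : x ∈ Ico 0 L)
    (hq0 : ∀ᵐ x ∂(volume.restrict (Ioo 0 L)), 0 ≤ q x) : 0 ≤ transportSol k μ c q x := by
  refine mul_nonneg (Real.exp_pos _).le (add_nonneg hc ?_)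
  rw [intervalIntegral.integral_of_le hx.1, integral_Ioc_eq_integral_Ioo]
  refine integral_nonneg_of_ae ?_
  filter_upwards [ae_restrict_of_ae_restrict_of_subset (Ioo_subset_Ioo_right hx.2.le) hq0] with s hs
  exact mul_nonneg (Real.exp_pos _).le hs

theorem integrableOn_rate_mul_transportSol_of_lt (hμ : IsRepairRate L N μ)
    (hq : IntegrableOn q (Ioo 0 L)) {l : ℝ} (h0 : 0 ≤ l) (hl : l < L) :
    IntegrableOn (fun x => (k + μ x) * transportSol k μ c q x) (Ioo 0 l) := by
  rw [← intervalIntegrable_iff_integrableOn_Ioo_of_le h0]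
  exact (intervalIntegrable_of_integrableOn_Ioo h0 (hμ.integrableOn_const_add k hl)).mul_continuousOn
    (absolutelyContinuousOnInterval_transportSol hμ hq h0 hl).continuousOn

/-- The integrated equation reads `u(l) + ∫₀ˡ (k + μ) u = c + ∫₀ˡ q`. As `u(l) ≥ 0`, the nonnegative
absorption term is bounded by `c + ∫₀ᴸ q` uniformly in `l`, and `l` tends to `L` along `L - L / (n +
1)`. -/
theorem integrableOn_rate_mul_transportSol_of_nonneg (hL : 0 < L) (hk : 0 ≤ k)
    (hμ : IsRepairRate L N μ) (hc : 0 ≤ c) (hq : IntegrableOn q (Ioo 0 L)) (hq0 : ∀ x, 0 ≤ q x) :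
    IntegrableOn (fun x => (k + μ x) * transportSol k μ c q x) (Ioo 0 L) := by
  have hb0 : ∀ n : ℕ, 0 ≤ L - L / ((n : ℝ) + 1) := fun n => by
    rw [sub_nonneg, div_le_iff₀ (by positivity)]
    nlinarith [(Nat.cast_nonneg n : (0 : ℝ) ≤ n)]
  have hbL : ∀ n : ℕ, L - L / ((n : ℝ) + 1) < L := fun n => by
    have : 0 < L / ((n : ℝ) + 1) := by positivity
    linarith
  have hb : Tendsto (fun n : ℕ => L - L / ((n : ℝ) + 1)) atTop (𝓝 L) := by
    simpa using (tendsto_const_div_atTop_nhds_zero_nat L).comp (tendsto_add_atTop_nat 1)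
      |>.const_sub L
  rw [← integrableOn_Ioc_iff_integrableOn_Ioo]
  refine integrableOn_Ioc_of_intervalIntegral_norm_bounded_right
    (I := c + ∫ x in Ioo 0 L, q x) (b := fun n : ℕ => L - L / ((n : ℝ) + 1)) (l := atTop)
    (fun n => ?_) hb (Eventually.of_forall fun n => ?_)
  · rw [integrableOn_Ioc_iff_integrableOn_Ioo]
    exact integrableOn_rate_mul_transportSol_of_lt hμ hq (hb0 n) (hbL n)
  · have hi := integrableOn_rate_mul_transportSol_of_lt (k := k) (c := c) hμ hq (hb0 n) (hbL n)
    have hqi := hq.mono_set (Ioo_subset_Ioo_right (hbL n).le)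
    have h1 := transportSol_eq (k := k) (c := c) hμ hq (hb0 n) (hbL n)
    rw [intervalIntegral.integral_of_le (hb0 n), integral_Ioc_eq_integral_Ioo,
      integral_sub hqi hi] at h1
    have h2 := transportSol_nonneg (k := k) (μ := μ) hc ⟨hb0 n, hbL n⟩ (Eventually.of_forall hq0)
    have h3 : ∫ x in Ioo 0 (L - L / ((n : ℝ) + 1)), q x ≤ ∫ x in Ioo 0 L, q x :=
      setIntegral_mono_set hq (Eventually.of_forall hq0)
        (Ioo_subset_Ioo_right (hbL n).le).eventuallyLE
    rw [integral_Ioc_eq_integral_Ioo]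
    have h4 : ∫ x in Ioo 0 (L - L / ((n : ℝ) + 1)), ‖(k + μ x) * transportSol k μ c q x‖ =
        ∫ x in Ioo 0 (L - L / ((n : ℝ) + 1)), (k + μ x) * transportSol k μ c q x := by
      refine setIntegral_congr_fun measurableSet_Ioo fun x hx => Real.norm_of_nonneg ?_
      have hx' : x ∈ Ico 0 L := ⟨hx.1.le, hx.2.trans (hbL n)⟩
      exact mul_nonneg (add_nonneg hk (hμ.nonneg x hx'))
        (transportSol_nonneg hc hx' (Eventually.of_forall hq0))
    rw [h4]
    linarith

theorem integrableOn_rate_mul_transportSol (hL : 0 < L) (hk : 0 ≤ k)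
    (hμ : IsRepairRate L N μ) (hq : IntegrableOn q (Ioo 0 L)) :
    IntegrableOn (fun x => (k + μ x) * transportSol k μ c q x) (Ioo 0 L) := by
  refine Integrable.mono' (integrableOn_rate_mul_transportSol_of_nonneg hL hk hμ (abs_nonneg c)
    hq.abs fun _ => abs_nonneg _) ((aestronglyMeasurable_const.add hμ.aestronglyMeasurable).mul
    ((continuousOn_transportSol hμ hq).aestronglyMeasurable measurableSet_Ioo)) ?_
  filter_upwards [ae_restrict_mem measurableSet_Ioo] with x hx
  have h1 := add_nonneg hk (hμ.nonneg x (Ioo_subset_Ico_self hx))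
  rw [norm_mul, Real.norm_of_nonneg h1]
  gcongr
  exact abs_transportSol_le hx

/-- Since `k + μ ≥ k > 0`, the solution is dominated by `k⁻¹` times the absorption term. -/
theorem integrableOn_transportSol (hL : 0 < L) (hk : 0 < k)
    (hμ : IsRepairRate L N μ) (hq : IntegrableOn q (Ioo 0 L)) :
    IntegrableOn (transportSol k μ c q) (Ioo 0 L) := by
  refine Integrable.mono' ((integrableOn_rate_mul_transportSol (c := c) hL hk.le hμ hq).norm.const_mul
    k⁻¹) ((continuousOn_transportSol hμ hq).aestronglyMeasurable measurableSet_Ioo) ?_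
  filter_upwards [ae_restrict_mem measurableSet_Ioo] with x hx
  have h1 := hμ.nonneg x (Ioo_subset_Ico_self hx)
  rw [norm_mul, Real.norm_of_nonneg (by positivity : 0 ≤ k + μ x)]
  rw [le_inv_mul_iff₀ hk]
  gcongr
  linarith

/-- Solvability of the resolvent equation of one component. -/
theorem exists_transport (hL : 0 < L) (hk : 0 < k) (hμ : IsRepairRate L N μ) (c : ℝ) (q : L1 L) :
    ∃ f g : L1 L, IsWeakDeriv f g ∧ HasValueAtZero f c ∧
      IntegrableOn (fun x => μ x * f x) (Ioo 0 L) ∧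
      (∀ᵐ x ∂(volume.restrict (Ioo 0 L)), g x = q x - (k * f x + μ x * f x)) ∧
      (0 ≤ c → 0 ≤ q → 0 ≤ f) := by
  have hq := L1.integrable q
  have hu := integrableOn_transportSol (c := c) hL hk hμ hq
  have hmu := integrableOn_rate_mul_transportSol (c := c) hL hk.le hμ hq
  have hg : IntegrableOn (fun x => q x - (k + μ x) * transportSol k μ c q x) (Ioo 0 L) := hq.sub hmu
  have hf' : hu.toL1 _ =ᵐ[volume.restrict (Ioo 0 L)] transportSol k μ c q := hu.coeFn_toL1
  have hg' : hg.toL1 _ =ᵐ[volume.restrict (Ioo 0 L)]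
    fun x => q x - (k + μ x) * transportSol k μ c q x := hg.coeFn_toL1
  have hp : hu.toL1 _ =ᵐ[volume.restrict (Ioo 0 L)]
      fun x => c + ∫ s in (0 : ℝ)..x, (hg.toL1 _ : L1 L) s := by
    filter_upwards [hf', ae_restrict_mem measurableSet_Ioo] with x h1 hx
    rw [h1, transportSol_eq hμ hq hx.1.le hx.2, intervalIntegral.integral_of_le hx.1.le,
      intervalIntegral.integral_of_le hx.1.le]
    congr 1
    exact (integral_congr_ae (ae_restrict_of_ae_restrict_of_subset
      (fun s (hs : s ∈ Ioc 0 x) => (⟨hs.1, hs.2.trans_lt hx.2⟩ : s ∈ Ioo 0 L)) hg')).symm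
  refine ⟨hu.toL1 _, hg.toL1 _, isWeakDeriv_of_primitive hL hp,
    ⟨_, continuousOn_primitive_Icc hL.le (L1.integrable _) c, hp, by simp⟩, ?_, ?_, fun hc hq0 => ?_⟩
  · refine (hmu.sub (hu.const_mul k)).congr ?_
    filter_upwards [hf'] with x h1
    rw [h1, Pi.sub_apply]; ring
  · filter_upwards [hf', hg'] with x h1 h2
    rw [h1, h2]; ring
  · rw [← Lp.coeFn_nonneg] at hq0 ⊢
    filter_upwards [hf', ae_restrict_mem measurableSet_Ioo] with x h1 hx
    rw [h1]
    exact transportSol_nonneg hc (Ioo_subset_Ico_self hx) hq0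

/-- Uniqueness for the resolvent equation of one component. -/
theorem transport_unique (hL : 0 < L) (hμ : IsRepairRate L N μ) {f g : L1 L}
    (hfg : IsWeakDeriv f g) (h0 : HasValueAtZero f 0)
    (hg : ∀ᵐ x ∂(volume.restrict (Ioo 0 L)), g x = -(k * f x + μ x * f x)) : f = 0 := by
  have hf := hfg.ae_eq_primitive hL h0
  apply Lp.ext
  filter_upwards [hf, Lp.coeFn_zero ℝ 1 (volume.restrict (Ioo 0 L)),
    ae_restrict_mem measurableSet_Ioo] with l e1 e2 hl
  rw [e1, e2, Pi.zero_apply]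
  have hgi := (L1.integrable g).mono_set (Ioo_subset_Ioo_right hl.2.le)
  -- Multiplied by the integrating factor `exp(hazard)`, the solution has derivative zero almost
  -- everywhere; being absolutely continuous and zero at `0`, it vanishes.
  have h1 := integral_eq_sub_of_ae_hasDerivAt (g := fun _ => 0) hl.1.le
    ((absolutelyContinuousOnInterval_exp
      (absolutelyContinuousOnInterval_hazard hμ k hl.1.le hl.2)).mul
      (absolutelyContinuousOnInterval_primitive hl.1.le hgi 0)) (by
    filter_upwards [ae_hasDerivAt_hazard hμ k hl.1.le hl.2,
      ae_hasDerivAt_primitive hl.1.le hgi 0, (ae_restrict_iff' measurableSet_Ioo).1 hf,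
      (ae_restrict_iff' measurableSet_Ioo).1 hg] with x h1 h2 h3 h4 hx
    have hx' : x ∈ Ioo 0 L := ⟨hx.1, hx.2.trans hl.2⟩
    refine ((h1 hx).exp.mul (h2 hx)).congr_deriv ?_
    rw [← h3 hx', h4 hx']
    ring)
  simp only [intervalIntegral.integral_zero, Pi.mul_apply, intervalIntegral.integral_same, add_zero,
    mul_zero, sub_zero] at h1
  exact (mul_eq_zero.1 h1.symm).resolve_left (Real.exp_pos _).ne'

/-- Since the repair rate has infinite integral, the trace at `L` vanishes. -/
theorem integral_weakDeriv_eq (hL : 0 < L) (hμ : IsRepairRate L N μ) {f g : L1 L}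
    (hfg : IsWeakDeriv f g) (hc : HasValueAtZero f c)
    (hi : IntegrableOn (fun x => μ x * f x) (Ioo 0 L)) : ∫ x in Ioo 0 L, g x = -c := by
  have hf := hfg.ae_eq_primitive hL hc
  have hcont := continuousOn_primitive_Icc hL.le (L1.integrable g) c
  set U : ℝ → ℝ := fun x => c + ∫ s in (0 : ℝ)..x, g s with hU
  suffices U L = 0 by
    rw [hU] at this
    simp only [intervalIntegral.integral_of_le hL.le, integral_Ioc_eq_integral_Ioo] at this
    linarith
  by_contra hne
  have hev : ∀ᶠ x in 𝓝[Icc 0 L] L, |U L| / 2 < |U x| :=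
    (hcont L (right_mem_Icc.2 hL.le)).abs.eventually (lt_mem_nhds (half_lt_self (abs_pos.2 hne)))
  obtain ⟨δ, hδ, hball⟩ := Metric.mem_nhdsWithin_iff.1 hev
  set l := max (L / 2) (L - δ / 2) with hl
  have hlL : l < L := max_lt (by linarith) (by linarith)
  have hl0 : 0 < l := lt_of_lt_of_le (by linarith) (le_max_left _ _)
  -- With a nonzero trace, `|f| > |U L| / 2` almost everywhere near `L`, so `μ` is dominated there
  -- by a multiple of the integrable `μ f`. This contradicts the infinite integral of `μ`.
  have h1 : IntegrableOn μ (Ioo l L) := by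
    have hsub : Ioo l L ⊆ Ioo 0 L := Ioo_subset_Ioo_left hl0.le
    refine Integrable.mono' ((hi.mono_set hsub).norm.const_mul (2 / |U L|))
      (hμ.aestronglyMeasurable.mono_measure (Measure.restrict_mono_set _ hsub)) ?_
    filter_upwards [ae_restrict_of_ae_restrict_of_subset hsub hf,
      ae_restrict_mem measurableSet_Ioo] with x h2 hx
    have h3 : |U L| / 2 < |U x| := by
      refine hball ⟨?_, ⟨hl0.le.trans hx.1.le, hx.2.le⟩⟩
      rw [Metric.mem_ball, Real.dist_eq, abs_lt]
      have := (le_max_right (L / 2) (L - δ / 2)).trans hx.1.le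
      constructor <;> linarith [hx.2]
    have hpos := abs_pos.2 hne
    rw [norm_mul, h2, Real.norm_eq_abs (U x)]
    calc ‖μ x‖ = 2 / |U L| * (‖μ x‖ * (|U L| / 2)) := by field_simp
      _ ≤ _ := by gcongr
  have h2 : IntegrableOn μ (Ioo 0 L) := by
    have : IntegrableOn μ (Ioc 0 l ∪ Ioo l L) :=
      ((integrableOn_Ioc_iff_integrableOn_Ioo (by simp)).2 (hμ.integrableOn_of_lt hlL)).union h1
    rwa [Ioc_union_Ioo_eq_Ioo hl0.le hlL] at this
  exact h2.lintegral_lt_top.ne hμ.lintegral_eq_top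

end Transport

/-! ### Density of the domain -/

section Density

variable {L : ℝ} {N : ℕ} {μ : ℝ → ℝ}

/-- A test function is approximated in `L¹(0, L)` by smooth functions that vanish near `L` and take a
prescribed value at `0`. -/
theorem exists_cutoff (hL : 0 < L) {h : ℝ → ℝ} (h1 : ContDiff ℝ ∞ h) (h2 : HasCompactSupport h)
    (c : ℝ) {ε : ℝ} (hε : 0 < ε) : ∃ (v : ℝ → ℝ) (l : ℝ), 0 < l ∧ l < L ∧ ContDiff ℝ ∞ v ∧ v 0 = c ∧
      (∀ x ∈ Ico l L, v x = 0) ∧ ∫ x in Ioo 0 L, ‖h x - v x‖ < ε := by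
  obtain ⟨C, hC⟩ := h1.continuous.bounded_above_of_compact_support h2
  have hC0 : 0 ≤ C := (norm_nonneg _).trans (hC 0)
  set D := C + |c| with hD
  have hD0 : 0 ≤ D := by positivity
  -- The bound `L / 8` makes the radii of the bumps positive and ordered. The second bound controls
  -- the error, which is at most `D` on two end strips of width `2 δ` and zero between them.
  set δ := min (L / 8) (ε / (8 * (D + 1))) with hδ
  have hδ0 : 0 < δ := by positivity
  have hδL : δ ≤ L / 8 := min_le_left _ _
  have hδε : 8 * δ * D < ε := by
    have : δ ≤ ε / (8 * (D + 1)) := min_le_right _ _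
    rw [le_div_iff₀ (by positivity)] at this
    nlinarith
  let B : ContDiffBump (L / 2) := ⟨L / 2 - 2 * δ, L / 2 - δ, by linarith, by linarith⟩
  let B₀ : ContDiffBump (0 : ℝ) := ⟨δ / 2, δ, by linarith, by linarith⟩
  have hBin : ∀ x ∈ Icc (2 * δ) (L - 2 * δ), B x = 1 := fun x hx => by
    refine B.one_of_mem_closedBall ?_
    rw [Metric.mem_closedBall, Real.dist_eq, abs_le]
    change -(L / 2 - 2 * δ) ≤ _ ∧ _ ≤ L / 2 - 2 * δ
    constructor <;> linarith [hx.1, hx.2]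
  have hBout : ∀ x, L / 2 - δ ≤ |x - L / 2| → B x = 0 := fun x hx =>
    B.zero_of_le_dist (by rw [Real.dist_eq]; exact hx)
  have hB₀out : ∀ x, δ ≤ x → B₀ x = 0 := fun x hx =>
    B₀.zero_of_le_dist (by rw [Real.dist_eq, sub_zero]; exact hx.trans (le_abs_self x))
  -- `B` cuts `h` off near both endpoints, and the narrow bump `B₀` restores the value `c` at `0`.
  have hv : ContDiff ℝ ∞ fun x => h x * B x + c * B₀ x :=
    (h1.mul B.contDiff).add (contDiff_const.mul B₀.contDiff)
  refine ⟨fun x => h x * B x + c * B₀ x, L - δ, by linarith, by linarith, hv, ?_, fun x hx => ?_, ?_⟩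
  · have e0 : B₀ 0 = 1 := B₀.one_of_mem_closedBall (Metric.mem_closedBall_self (by positivity))
    have e1 : B 0 = 0 := hBout 0 (by rw [zero_sub, abs_neg, abs_of_pos (by positivity)]; linarith)
    simp only [e0, e1]; ring
  · have e1 : B x = 0 := hBout x (by rw [abs_of_nonneg (by linarith [hx.1])]; linarith [hx.1])
    simp only [e1, hB₀out x (by linarith [hx.1])]; ring
  · set F : ℝ → ℝ := fun x => ‖h x - (h x * B x + c * B₀ x)‖ with hF
    have hFc : Continuous F := (h1.continuous.sub hv.continuous).norm
    have hFi : ∀ a b, IntervalIntegrable F volume a b := fun a b => hFc.intervalIntegrable a b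
    have hFD : ∀ x, ‖F x‖ ≤ D := fun x => by
      have e : h x - (h x * B x + c * B₀ x) = h x * (1 - B x) - c * B₀ x := by ring
      rw [hF, norm_norm, e]
      refine (norm_sub_le _ _).trans ?_
      rw [norm_mul, norm_mul, Real.norm_of_nonneg (sub_nonneg.2 B.le_one),
        Real.norm_of_nonneg B₀.nonneg, hD, Real.norm_eq_abs c]
      refine add_le_add ((mul_le_of_le_one_right (norm_nonneg _) (by linarith [B.nonneg (x := x)])).trans
        (hC x)) (mul_le_of_le_one_right (abs_nonneg _) B₀.le_one)
    have i1 := intervalIntegral.norm_integral_le_of_norm_le_const (f := F) (a := 0) (b := 2 * δ)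
      (C := D) fun x _ => hFD x
    have i2 := intervalIntegral.norm_integral_le_of_norm_le_const (f := F) (a := 2 * δ)
      (b := L - 2 * δ) (C := 0) fun x hx => by
        rw [uIoc_of_le (by linarith)] at hx
        have e1 := hBin x (Ioc_subset_Icc_self hx)
        have e2 := hB₀out x (by linarith [hx.1])
        simp [hF, e1, e2]
    have i3 := intervalIntegral.norm_integral_le_of_norm_le_const (f := F) (a := L - 2 * δ) (b := L)
      (C := D) fun x _ => hFD x
    rw [sub_zero, abs_of_pos (by positivity)] at i1
    rw [zero_mul] at i2
    rw [sub_sub_cancel, abs_of_pos (by positivity)] at i3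
    rw [← integral_Ioc_eq_integral_Ioo, ← intervalIntegral.integral_of_le hL.le,
      ← intervalIntegral.integral_add_adjacent_intervals (hFi 0 (L - 2 * δ)) (hFi _ L),
      ← intervalIntegral.integral_add_adjacent_intervals (hFi 0 (2 * δ)) (hFi _ _)]
    have j1 := (Real.le_norm_self _).trans i1
    have j2 := (Real.le_norm_self _).trans i2
    have j3 := (Real.le_norm_self _).trans i3
    nlinarith

/-- Weakly differentiable functions with a prescribed trace at `0` are dense. -/
theorem exists_weakDeriv_norm_sub_lt (hL : 0 < L) (hμ : IsRepairRate L N μ) (f : L1 L) (c : ℝ)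
    {ε : ℝ} (hε : 0 < ε) : ∃ f' : L1 L, (∃ g, IsWeakDeriv f' g) ∧ HasValueAtZero f' c ∧
      IntegrableOn (fun x => μ x * f' x) (Ioo 0 L) ∧ ‖f - f'‖ < ε := by
  obtain ⟨H, ⟨h, hH, h2, h1⟩, hfH⟩ := Metric.mem_closure_iff.1
    (Lp.dense_hasCompactSupport_contDiff (F := ℝ) (μ := volume.restrict (Ioo 0 L))
      (p := 1) ENNReal.one_ne_top f) (ε / 2) (by positivity)
  obtain ⟨v, l, hl0, hlL, hv, hv0, hvl, hhv⟩ := exists_cutoff hL h1 h2 c (half_pos hε)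
  have hci : ∀ {w : ℝ → ℝ}, Continuous w → Integrable w (volume.restrict (Ioo 0 L)) := fun hw =>
    (hw.continuousOn.integrableOn_Icc (a := 0) (b := L)).mono_set Ioo_subset_Icc_self
  have hvi := hci hv.continuous
  have hv'c : Continuous (deriv v) := hv.continuous_deriv (by simp)
  have hv'i := hci hv'c
  have hp : hvi.toL1 v =ᵐ[volume.restrict (Ioo 0 L)]
      fun x => c + ∫ s in (0 : ℝ)..x, (hv'i.toL1 _ : L1 L) s := by
    filter_upwards [hvi.coeFn_toL1, ae_restrict_mem measurableSet_Ioo] with x e1 hx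
    have e2 : ∫ s in (0 : ℝ)..x, deriv v s = v x - v 0 :=
      intervalIntegral.integral_deriv_eq_sub (fun y _ => (hv.differentiable (by simp)) y)
        (hv'c.intervalIntegrable _ _)
    have e3 : ∫ s in (0 : ℝ)..x, (hv'i.toL1 _ : L1 L) s = ∫ s in (0 : ℝ)..x, deriv v s := by
      rw [intervalIntegral.integral_of_le hx.1.le, intervalIntegral.integral_of_le hx.1.le]
      exact integral_congr_ae (ae_restrict_of_ae_restrict_of_subset
        (fun s (hs : s ∈ Ioc 0 x) => (⟨hs.1, hs.2.trans_lt hx.2⟩ : s ∈ Ioo 0 L)) hv'i.coeFn_toL1)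
    rw [e1, e3, e2, hv0]; ring
  refine ⟨hvi.toL1 v, ⟨hv'i.toL1 _, isWeakDeriv_of_primitive hL hp⟩,
    ⟨v, hv.continuous.continuousOn, hvi.coeFn_toL1, hv0⟩, ?_, ?_⟩
  · have h3 : IntegrableOn (fun x => μ x * v x) (Ioo 0 L) := by
      rw [← Ioo_union_Ico_eq_Ioo hl0 hlL.le]
      refine IntegrableOn.union ?_ ?_
      · rw [← intervalIntegrable_iff_integrableOn_Ioo_of_le hl0.le]
        exact (intervalIntegrable_of_integrableOn_Ioo hl0.le
          (hμ.integrableOn_of_lt hlL)).mul_continuousOn hv.continuous.continuousOn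
      · refine integrableOn_zero.congr_fun (fun x hx => ?_) measurableSet_Ico
        rw [hvl x hx, mul_zero]
    refine h3.congr ?_
    filter_upwards [hvi.coeFn_toL1] with x e1
    rw [e1]
  · have h3 : ‖H - hvi.toL1 v‖ < ε / 2 := by
      rw [L1.norm_eq_integral_norm]
      refine (integral_congr_ae ?_).trans_lt hhv
      filter_upwards [Lp.coeFn_sub H (hvi.toL1 v), hH, hvi.coeFn_toL1] with x e1 e2 e3
      rw [e1, Pi.sub_apply, e2, e3]
    rw [dist_eq_norm] at hfH
    calc ‖f - hvi.toL1 v‖ = ‖(f - H) + (H - hvi.toL1 v)‖ := by rw [sub_add_sub_cancel]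
      _ < ε := (norm_add_le _ _).trans_lt (by linarith)

/-- The boundary conditions are triangular: with `p₀` kept, the first component is approximated
first, and its integral then fixes the trace prescribed for the second. -/
theorem dense_domain_systemOperator (hL : 0 < L) {lam₁ lam₂ : ℝ} {μ₁ μ₂ : ℝ → ℝ}
    (hμ₁ : IsRepairRate L N μ₁) (hμ₂ : IsRepairRate L N μ₂) :
    Dense ((systemOperator L lam₁ lam₂ μ₁ μ₂).domain : Set (X L)) := by
  intro p
  rw [Metric.mem_closure_iff]
  intro ε hε
  obtain ⟨f₁, w₁, v₁, i₁, n₁⟩ :=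
    exists_weakDeriv_norm_sub_lt hL hμ₁ (p₁ p) (lam₁ * p₀ p) (half_pos hε)
  obtain ⟨f₂, w₂, v₂, i₂, n₂⟩ := exists_weakDeriv_norm_sub_lt hL hμ₂ (p₂ p)
    (lam₂ * p₀ p + lam₂ * ∫ x in Ioo 0 L, f₁ x) (half_pos hε)
  refine ⟨WithLp.toLp 1 (p₀ p, WithLp.toLp 1 (f₁, f₂)),
    (mem_domain_systemOperator _).2 ⟨w₁, w₂, i₁, i₂, v₁, v₂⟩, ?_⟩
  rw [dist_eq_norm, norm_eq]
  change |p₀ p - p₀ p| + ‖p₁ p - f₁‖ + ‖p₂ p - f₂‖ < ε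
  rw [sub_self, abs_zero]
  linarith

end Density

/-! ### Additivity of the norm on the positive cone -/

section Order

variable {L : ℝ}

theorem norm_eq_integral_of_nonneg {f : L1 L} (hf : 0 ≤ f) : ‖f‖ = ∫ x in Ioo 0 L, f x := by
  rw [L1.norm_eq_integral_norm]
  rw [← Lp.coeFn_nonneg] at hf
  refine integral_congr_ae ?_
  filter_upwards [hf] with x hx using Real.norm_of_nonneg hx

theorem integral_coeFn_add (f g : L1 L) :
    ∫ x in Ioo 0 L, (f + g : L1 L) x = (∫ x in Ioo 0 L, f x) + ∫ x in Ioo 0 L, g x := by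
  rw [← integral_add (L1.integrable f) (L1.integrable g)]
  exact integral_congr_ae (Lp.coeFn_add f g)

theorem integral_coeFn_smul (c : ℝ) (f : L1 L) :
    ∫ x in Ioo 0 L, (c • f : L1 L) x = c * ∫ x in Ioo 0 L, f x := by
  rw [← integral_const_mul]
  exact integral_congr_ae (Lp.coeFn_smul c f)

theorem L1.smul_nonneg {c : ℝ} (hc : 0 ≤ c) {f : L1 L} (hf : 0 ≤ f) : 0 ≤ c • f := by
  rw [← Lp.coeFn_nonneg] at hf ⊢
  filter_upwards [hf, Lp.coeFn_smul c f] with x hx e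
  rw [e]
  exact mul_nonneg hc hx

theorem norm_posPart_add_norm_negPart (f : L1 L) : ‖f⁺‖ + ‖f⁻‖ = ‖f‖ := by
  rw [norm_eq_integral_of_nonneg (posPart_nonneg f), norm_eq_integral_of_nonneg (negPart_nonneg f),
    ← integral_coeFn_add, posPart_add_negPart, ← norm_eq_integral_of_nonneg (abs_nonneg f),
    norm_abs_eq_norm]

theorem setIntegral_mul_nonneg {μ : ℝ → ℝ} (hμ : ∀ x ∈ Ico 0 L, 0 ≤ μ x) {f : L1 L} (hf : 0 ≤ f) :
    0 ≤ ∫ x in Ioo 0 L, μ x * f x := by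
  rw [← Lp.coeFn_nonneg] at hf
  refine integral_nonneg_of_ae ?_
  filter_upwards [hf, ae_restrict_mem measurableSet_Ioo] with x h1 h2
  exact mul_nonneg (hμ x (Ioo_subset_Ico_self h2)) h1

theorem setIntegral_nonneg_of_nonneg {f : L1 L} (hf : 0 ≤ f) : 0 ≤ ∫ x in Ioo 0 L, f x := by
  rw [← norm_eq_integral_of_nonneg hf]; exact norm_nonneg f

theorem norm_eq_of_isNonneg {p : X L} (hp : IsNonneg p) :
    ‖p‖ = p₀ p + (∫ x in Ioo 0 L, p₁ p x) + ∫ x in Ioo 0 L, p₂ p x := by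
  rw [norm_eq, abs_of_nonneg hp.1, norm_eq_integral_of_nonneg hp.2.1,
    norm_eq_integral_of_nonneg hp.2.2]

/-- The norm is additive over the positive and negative parts. A norm bound for an additive map on
the cone therefore extends to all states with the same constant. -/
theorem exists_isNonneg_sub (p : X L) :
    ∃ q r : X L, IsNonneg q ∧ IsNonneg r ∧ p = q - r ∧ ‖q‖ + ‖r‖ = ‖p‖ := by
  refine ⟨WithLp.toLp 1 ((p₀ p)⁺, WithLp.toLp 1 ((p₁ p)⁺, (p₂ p)⁺)),
    WithLp.toLp 1 ((p₀ p)⁻, WithLp.toLp 1 ((p₁ p)⁻, (p₂ p)⁻)),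
    ⟨posPart_nonneg _, posPart_nonneg _, posPart_nonneg _⟩,
    ⟨negPart_nonneg _, negPart_nonneg _, negPart_nonneg _⟩, ?_, ?_⟩
  · exact WithLp.ofLp_injective 1 (Prod.ext (posPart_sub_negPart (p₀ p)).symm
      (WithLp.ofLp_injective 1 (Prod.ext (posPart_sub_negPart (p₁ p)).symm
        (posPart_sub_negPart (p₂ p)).symm)))
  · rw [norm_eq, norm_eq, norm_eq]
    change |(p₀ p)⁺| + ‖(p₁ p)⁺‖ + ‖(p₂ p)⁺‖ + (|(p₀ p)⁻| + ‖(p₁ p)⁻‖ + ‖(p₂ p)⁻‖) = _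
    rw [← norm_posPart_add_norm_negPart (p₁ p), ← norm_posPart_add_norm_negPart (p₂ p),
      ← posPart_add_negPart (p₀ p), abs_of_nonneg (posPart_nonneg (p₀ p)),
      abs_of_nonneg (negPart_nonneg (p₀ p))]
    ring

/-- The cone of nonnegative states. -/
def nonnegCone (L : ℝ) : AddSubmonoid (X L) where
  carrier := {p | IsNonneg p}
  add_mem' h h' := ⟨add_nonneg h.1 h'.1, add_nonneg h.2.1 h'.2.1, add_nonneg h.2.2 h'.2.2⟩
  zero_mem' := ⟨le_rfl, le_rfl, le_rfl⟩

theorem isClosed_nonnegCone : IsClosed (nonnegCone L : Set (X L)) := by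
  have h0 : Continuous (p₀ : X L → ℝ) := by unfold p₀; fun_prop
  have h1 : Continuous (p₁ : X L → L1 L) := by unfold p₁; fun_prop
  have h2 : Continuous (p₂ : X L → L1 L) := by unfold p₂; fun_prop
  exact ((isClosed_Ici (a := (0 : ℝ))).preimage h0).inter
    (((isClosed_Ici (a := (0 : L1 L))).preimage h1).inter
      ((isClosed_Ici (a := (0 : L1 L))).preimage h2))

end Order

/-! ### The resolvent of the system operator -/

section Resolvent

variable {L k c : ℝ} {N : ℕ} {μ : ℝ → ℝ}

/-- `f` solves the resolvent equation `f' = q - (k + μ) f`, `f(0) = c` of one component. -/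
def SolvesTransport (k : ℝ) (μ : ℝ → ℝ) (c : ℝ) (q f : L1 L) : Prop :=
  HasValueAtZero f c ∧ IntegrableOn (fun x => μ x * f x) (Ioo 0 L) ∧
    ∃ g : L1 L, IsWeakDeriv f g ∧
      ∀ᵐ x ∂(volume.restrict (Ioo 0 L)), g x = q x - (k * f x + μ x * f x)

theorem SolvesTransport.add {c' : ℝ} {q f q' f' : L1 L} (h : SolvesTransport k μ c q f)
    (h' : SolvesTransport k μ c' q' f') : SolvesTransport k μ (c + c') (q + q') (f + f') := by
  obtain ⟨hc, hi, g, hg, e⟩ := h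
  obtain ⟨hc', hi', g', hg', e'⟩ := h'
  refine ⟨hc.add hc', (integral_add_eq f f' μ hi hi').1, g + g', hg.add hg', ?_⟩
  filter_upwards [e, e', Lp.coeFn_add g g', Lp.coeFn_add q q', Lp.coeFn_add f f']
    with x h1 h2 h3 h4 h5
  rw [h3, h4, h5, Pi.add_apply, Pi.add_apply, Pi.add_apply, h1, h2]
  ring

theorem SolvesTransport.smul {q f : L1 L} (a : ℝ) (h : SolvesTransport k μ c q f) :
    SolvesTransport k μ (a * c) (a • q) (a • f) := by
  obtain ⟨hc, hi, g, hg, e⟩ := h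
  refine ⟨hc.smul a, (integral_smul_eq a f μ hi).1, a • g, hg.smul a, ?_⟩
  filter_upwards [e, Lp.coeFn_smul a g, Lp.coeFn_smul a q, Lp.coeFn_smul a f] with x h1 h3 h4 h5
  rw [h3, h4, h5, Pi.smul_apply, Pi.smul_apply, Pi.smul_apply, h1]
  simp only [smul_eq_mul]
  ring

theorem SolvesTransport.eq_of_solvesTransport (hL : 0 < L) (hμ : IsRepairRate L N μ) {q f f' : L1 L}
    (h : SolvesTransport k μ c q f) (h' : SolvesTransport k μ c q f') : f = f' := by
  have h1 := h.add (h'.smul (-1))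
  rw [show c + -1 * c = 0 by ring, show q + (-1 : ℝ) • q = 0 by module] at h1
  obtain ⟨h2, -, g, hg, e⟩ := h1
  have h3 : f + (-1 : ℝ) • f' = 0 := by
    refine transport_unique (k := k) hL hμ hg h2 ?_
    filter_upwards [e, coeFn_zero_ae L] with x h4 h5
    rw [h4, h5, zero_sub]
  rw [← sub_eq_zero, ← h3]
  module

/-- Integrate the equation over `(0, L)`: the trace at `L` vanishes, so the derivative contributes
only `-c`. -/
theorem SolvesTransport.balance (hL : 0 < L) (hμ : IsRepairRate L N μ) {q f : L1 L}
    (h : SolvesTransport k μ c q f) :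
    (k * ∫ x in Ioo 0 L, f x) + ∫ x in Ioo 0 L, μ x * f x = c + ∫ x in Ioo 0 L, q x := by
  obtain ⟨hc, hi, g, hg, e⟩ := h
  have h1 := integral_weakDeriv_eq hL hμ hg hc hi
  have hs : IntegrableOn (fun x => k * f x + μ x * f x) (Ioo 0 L) :=
    ((L1.integrable f).const_mul k).add hi
  rw [integral_congr_ae e, integral_sub (L1.integrable q) hs, integral_add ((L1.integrable f).const_mul k) hi, integral_const_mul] at h1
  linarith

theorem exists_solvesTransport (hL : 0 < L) (hk : 0 < k) (hμ : IsRepairRate L N μ) (c : ℝ)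
    (q : L1 L) : ∃ f : L1 L, SolvesTransport k μ c q f ∧ (0 ≤ c → 0 ≤ q → 0 ≤ f) := by
  obtain ⟨f, g, h1, h2, h3, h4, h5⟩ := exists_transport hL hk hμ c q
  exact ⟨f, ⟨h2, h3, g, h1, h4⟩, h5⟩

variable {lam₁ lam₂ γ : ℝ} {μ₁ μ₂ : ℝ → ℝ}

/-- The resolvent equation of the system in terms of its components. -/
theorem mem_graph_iff_solvesTransport (p q : X L) :
    (p, γ • p - q) ∈ (systemOperator L lam₁ lam₂ μ₁ μ₂).graph ↔
      SolvesTransport (γ + lam₂) μ₁ (lam₁ * p₀ p) (p₁ q) (p₁ p) ∧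
      SolvesTransport γ μ₂ (lam₂ * p₀ p + lam₂ * ∫ x in Ioo 0 L, p₁ p x) (p₂ q) (p₂ p) ∧
      γ * p₀ p - p₀ q = -(lam₁ + lam₂) * p₀ p + (∫ x in Ioo 0 L, μ₁ x * p₁ p x)
        + ∫ x in Ioo 0 L, μ₂ x * p₂ p x := by
  have e₁ : p₁ (γ • p - q) = γ • p₁ p - p₁ q := rfl
  have e₂ : p₂ (γ • p - q) = γ • p₂ p - p₂ q := rfl
  have a₁ : ∀ᵐ x ∂(volume.restrict (Ioo 0 L)), p₁ (γ • p - q) x = γ * p₁ p x - p₁ q x := by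
    filter_upwards [Lp.coeFn_sub (γ • p₁ p) (p₁ q), Lp.coeFn_smul γ (p₁ p)] with x h1 h2
    rw [e₁, h1, Pi.sub_apply, h2, Pi.smul_apply, smul_eq_mul]
  have a₂ : ∀ᵐ x ∂(volume.restrict (Ioo 0 L)), p₂ (γ • p - q) x = γ * p₂ p x - p₂ q x := by
    filter_upwards [Lp.coeFn_sub (γ • p₂ p) (p₂ q), Lp.coeFn_smul γ (p₂ p)] with x h1 h2
    rw [e₂, h1, Pi.sub_apply, h2, Pi.smul_apply, smul_eq_mul]
  rw [mem_graph_systemOperator]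
  constructor
  · rintro ⟨hd, hi⟩
    refine ⟨⟨hd.boundary₁, hd.integrable₁, ?_⟩, ⟨hd.boundary₂, hd.integrable₂, ?_⟩, hi.eq₀⟩
    · obtain ⟨g, hg, e⟩ := hi.eq₁
      refine ⟨g, hg, ?_⟩
      filter_upwards [e, a₁] with x h1 h2
      linarith
    · obtain ⟨g, hg, e⟩ := hi.eq₂
      refine ⟨g, hg, ?_⟩
      filter_upwards [e, a₂] with x h1 h2
      linarith
  · rintro ⟨⟨b₁, i₁, g₁, w₁, d₁⟩, ⟨b₂, i₂, g₂, w₂, d₂⟩, h0⟩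
    refine ⟨⟨⟨g₁, w₁⟩, ⟨g₂, w₂⟩, i₁, i₂, b₁, b₂⟩, h0, ⟨g₁, w₁, ?_⟩, ⟨g₂, w₂, ?_⟩⟩
    · filter_upwards [d₁, a₁] with x h1 h2
      linarith
    · filter_upwards [d₂, a₂] with x h1 h2
      linarith

/-- The operator conserves the total mass, so the resolvent multiplies it by `1 / γ`. -/
theorem mass_resolvent (hL : 0 < L) (hμ₁ : IsRepairRate L N μ₁) (hμ₂ : IsRepairRate L N μ₂)
    {p q : X L} (h : (p, γ • p - q) ∈ (systemOperator L lam₁ lam₂ μ₁ μ₂).graph) :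
    γ * (p₀ p + (∫ x in Ioo 0 L, p₁ p x) + ∫ x in Ioo 0 L, p₂ p x) =
      p₀ q + (∫ x in Ioo 0 L, p₁ q x) + ∫ x in Ioo 0 L, p₂ q x := by
  obtain ⟨h1, h2, h3⟩ := (mem_graph_iff_solvesTransport p q).1 h
  have b1 := h1.balance hL hμ₁
  have b2 := h2.balance hL hμ₂
  linarith

/-- This quantity is the coefficient of `p₀` after eliminating `p₁` and `p₂`. The balances `∫ μ₁ f₁
= 1 - (γ + λ₂) ∫ f₁` and `∫ μ₂ f₂ = 1 - γ ∫ f₂` turn it into `γ` plus nonnegative terms. -/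
theorem characteristic_pos (hL : 0 < L) (hlam₁ : 0 < lam₁) (hlam₂ : 0 < lam₂)
    (hμ₁ : IsRepairRate L N μ₁) (hμ₂ : IsRepairRate L N μ₂) (hγ : 0 < γ) {f₁ f₂ : L1 L}
    (h₁ : SolvesTransport (γ + lam₂) μ₁ 1 0 f₁) (h₂ : SolvesTransport γ μ₂ 1 0 f₂)
    (n₁ : 0 ≤ f₁) (n₂ : 0 ≤ f₂) :
    0 < γ + lam₁ + lam₂ - lam₁ * (∫ x in Ioo 0 L, μ₁ x * f₁ x)
      - (lam₂ + lam₂ * (lam₁ * ∫ x in Ioo 0 L, f₁ x)) * ∫ x in Ioo 0 L, μ₂ x * f₂ x := by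
  have b1 := h₁.balance hL hμ₁
  have b2 := h₂.balance hL hμ₂
  rw [integral_congr_ae (coeFn_zero_ae L), integral_zero, add_zero] at b1 b2
  have i1 := setIntegral_nonneg_of_nonneg n₁
  have i2 := setIntegral_nonneg_of_nonneg n₂
  set E₁ := ∫ x in Ioo 0 L, f₁ x
  set E₂ := ∫ x in Ioo 0 L, f₂ x
  rw [← eq_sub_iff_add_eq'] at b1 b2
  rw [b1, b2]
  have : γ + lam₁ + lam₂ - lam₁ * (1 - (γ + lam₂) * E₁)
      - (lam₂ + lam₂ * (lam₁ * E₁)) * (1 - γ * E₂) =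
      γ + lam₁ * γ * E₁ + (lam₂ + lam₂ * (lam₁ * E₁)) * (γ * E₂) := by ring
  rw [this]
  positivity

/-- Superposition: `f₁`, `f₂` carry unit boundary values without source, and `r₁`, `r₂` carry the
source with zero boundary value. With `p₀ = z` unknown, the first equation becomes `a z = b`, where
`a > 0`; for nonnegative data `b` and all ingredients are nonnegative. -/
theorem exists_resolvent_apply (hL : 0 < L) (hlam₁ : 0 < lam₁) (hlam₂ : 0 < lam₂)
    (hμ₁ : IsRepairRate L N μ₁) (hμ₂ : IsRepairRate L N μ₂) (hγ : 0 < γ) (q : X L) :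
    ∃ p : X L, (p, γ • p - q) ∈ (systemOperator L lam₁ lam₂ μ₁ μ₂).graph ∧
      (IsNonneg q → IsNonneg p) := by
  obtain ⟨f₁, hf₁, n₁⟩ := exists_solvesTransport hL (add_pos hγ hlam₂) hμ₁ 1 0
  obtain ⟨f₂, hf₂, n₂⟩ := exists_solvesTransport hL hγ hμ₂ 1 0
  replace n₁ := n₁ zero_le_one le_rfl
  replace n₂ := n₂ zero_le_one le_rfl
  obtain ⟨r₁, hr₁, m₁⟩ := exists_solvesTransport hL (add_pos hγ hlam₂) hμ₁ 0 (p₁ q)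
  obtain ⟨r₂, hr₂, m₂⟩ := exists_solvesTransport hL hγ hμ₂ 0 (p₂ q)
  have ha := characteristic_pos hL hlam₁ hlam₂ hμ₁ hμ₂ hγ hf₁ hf₂ n₁ n₂
  set a := γ + lam₁ + lam₂ - lam₁ * (∫ x in Ioo 0 L, μ₁ x * f₁ x)
    - (lam₂ + lam₂ * (lam₁ * ∫ x in Ioo 0 L, f₁ x)) * ∫ x in Ioo 0 L, μ₂ x * f₂ x with ha'
  set b := p₀ q + (∫ x in Ioo 0 L, μ₁ x * r₁ x) +
    lam₂ * (∫ x in Ioo 0 L, r₁ x) * (∫ x in Ioo 0 L, μ₂ x * f₂ x) +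
    ∫ x in Ioo 0 L, μ₂ x * r₂ x with hb
  set z := b / a with hz
  have hza : a * z = b := by rw [hz]; field_simp
  set s₁ : L1 L := (lam₁ * z) • f₁ + r₁ with hs₁
  set d := lam₂ * z + lam₂ * ∫ x in Ioo 0 L, s₁ x with hd
  set s₂ : L1 L := d • f₂ + r₂ with hs₂
  refine ⟨WithLp.toLp 1 (z, WithLp.toLp 1 (s₁, s₂)), (mem_graph_iff_solvesTransport _ _).2 ⟨?_, ?_, ?_⟩,
    fun hq => ?_⟩
  · have := (hf₁.smul (lam₁ * z)).add hr₁
    rwa [mul_one, add_zero, smul_zero, zero_add] at this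
  · have := (hf₂.smul d).add hr₂
    rwa [mul_one, add_zero, smul_zero, zero_add] at this
  · change γ * z - p₀ q = -(lam₁ + lam₂) * z + (∫ x in Ioo 0 L, μ₁ x * s₁ x)
      + ∫ x in Ioo 0 L, μ₂ x * s₂ x
    have j1 := (integral_add_eq ((lam₁ * z) • f₁) r₁ μ₁ (integral_smul_eq _ _ _ hf₁.2.1).1 hr₁.2.1).2
    have j2 := (integral_add_eq (d • f₂) r₂ μ₂ (integral_smul_eq _ _ _ hf₂.2.1).1 hr₂.2.1).2
    rw [(integral_smul_eq _ _ _ hf₁.2.1).2] at j1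
    rw [(integral_smul_eq _ _ _ hf₂.2.1).2] at j2
    rw [hs₂, j2, hd, hs₁, integral_coeFn_add, integral_coeFn_smul, j1]
    rw [ha', hb] at hza
    linarith
  · obtain ⟨q0, q1, q2⟩ := hq
    replace m₁ := m₁ le_rfl q1
    replace m₂ := m₂ le_rfl q2
    have hb0 : 0 ≤ b := by
      have := setIntegral_mul_nonneg hμ₁.nonneg m₁
      have := setIntegral_mul_nonneg hμ₂.nonneg m₂
      have := setIntegral_mul_nonneg hμ₂.nonneg n₂
      have := setIntegral_nonneg_of_nonneg m₁
      positivity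
    have hz0 : 0 ≤ z := div_nonneg hb0 ha.le
    have hs0 : 0 ≤ s₁ := add_nonneg (L1.smul_nonneg (by positivity) n₁) m₁
    have hd0 : 0 ≤ d := by
      have := setIntegral_nonneg_of_nonneg hs0
      positivity
    exact ⟨hz0, hs0, add_nonneg (L1.smul_nonneg hd0 n₂) m₂⟩

/-- Without source, uniqueness for each transport equation forces the components to be multiples of
`f₁` and `f₂`. The scalar equation is then `a p₀ = 0` with `a > 0`, and the remaining components
vanish in turn. -/
theorem resolvent_apply_unique (hL : 0 < L) (hlam₁ : 0 < lam₁) (hlam₂ : 0 < lam₂)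
    (hμ₁ : IsRepairRate L N μ₁) (hμ₂ : IsRepairRate L N μ₂) (hγ : 0 < γ) {p : X L}
    (h : (p, γ • p) ∈ (systemOperator L lam₁ lam₂ μ₁ μ₂).graph) : p = 0 := by
  rw [← sub_zero (γ • p)] at h
  obtain ⟨h1, h2, h3⟩ := (mem_graph_iff_solvesTransport p 0).1 h
  obtain ⟨f₁, hf₁, n₁⟩ := exists_solvesTransport hL (add_pos hγ hlam₂) hμ₁ 1 0
  obtain ⟨f₂, hf₂, n₂⟩ := exists_solvesTransport hL hγ hμ₂ 1 0
  have ha := characteristic_pos hL hlam₁ hlam₂ hμ₁ hμ₂ hγ hf₁ hf₂ (n₁ zero_le_one le_rfl)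
    (n₂ zero_le_one le_rfl)
  have e₁ : p₁ p = (lam₁ * p₀ p) • f₁ := by
    have := hf₁.smul (lam₁ * p₀ p)
    rw [mul_one, smul_zero] at this
    exact h1.eq_of_solvesTransport hL hμ₁ this
  have e₂ : p₂ p = (lam₂ * p₀ p + lam₂ * ∫ x in Ioo 0 L, p₁ p x) • f₂ := by
    have := hf₂.smul (lam₂ * p₀ p + lam₂ * ∫ x in Ioo 0 L, p₁ p x)
    rw [mul_one, smul_zero] at this
    exact h2.eq_of_solvesTransport hL hμ₂ this
  rw [e₂, (integral_smul_eq _ _ _ hf₂.2.1).2, e₁, (integral_smul_eq _ _ _ hf₁.2.1).2,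
    integral_coeFn_smul] at h3
  have e₀ : p₀ p = 0 := by
    refine (mul_eq_zero.1 ?_).resolve_left ha.ne'
    have : p₀ (0 : X L) = 0 := rfl
    rw [this] at h3
    linarith
  have e₁' : p₁ p = 0 := by rw [e₁, e₀, mul_zero, zero_smul]
  have e₂' : p₂ p = 0 := by
    rw [e₂, e₁', e₀, integral_congr_ae (coeFn_zero_ae L), integral_zero, mul_zero, add_zero,
      zero_smul]
  exact WithLp.ofLp_injective 1 (Prod.ext e₀ (WithLp.ofLp_injective 1 (Prod.ext e₁' e₂')))

/-- Uniqueness makes the pointwise chosen solutions depend linearly on the data. On the cone the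
norm is the total mass, which is multiplied exactly by `γ⁻¹`; the decomposition into nonnegative
parts gives the operator bound. -/
theorem exists_resolvent (hL : 0 < L) (hlam₁ : 0 < lam₁) (hlam₂ : 0 < lam₂)
    (hμ₁ : IsRepairRate L N μ₁) (hμ₂ : IsRepairRate L N μ₂) (hγ : 0 < γ) :
    ∃ R : X L →L[ℝ] X L, ‖R‖ ≤ γ⁻¹ ∧
      (∀ x y, (x, y) ∈ (systemOperator L lam₁ lam₂ μ₁ μ₂).graph ↔ R (γ • x - y) = x) ∧
      ∀ x, IsNonneg x → IsNonneg (R x) := by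
  choose R hR hpos using
    exists_resolvent_apply (lam₁ := lam₁) hL hlam₁ hlam₂ hμ₁ hμ₂ hγ
  have huniq : ∀ p q, (p, γ • p - q) ∈ (systemOperator L lam₁ lam₂ μ₁ μ₂).graph → R q = p := by
    intro p q hp
    have h1 := Submodule.sub_mem _ (hR q) hp
    rw [Prod.mk_sub_mk, sub_sub_sub_cancel_right, ← smul_sub] at h1
    exact sub_eq_zero.1 (resolvent_apply_unique hL hlam₁ hlam₂ hμ₁ hμ₂ hγ h1)
  have hsub : ∀ x y, R (x - y) = R x - R y := fun x y => huniq _ _ (by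
    have := Submodule.sub_mem _ (hR x) (hR y)
    rw [Prod.mk_sub_mk] at this
    convert this using 2
    module)
  have hnonneg : ∀ q, IsNonneg q → ‖R q‖ = γ⁻¹ * ‖q‖ := by
    intro q hq
    rw [norm_eq_of_isNonneg (hpos q hq), norm_eq_of_isNonneg hq,
      ← mass_resolvent hL hμ₁ hμ₂ (hR q)]
    field_simp
  have hnorm : ∀ q, ‖R q‖ ≤ γ⁻¹ * ‖q‖ := by
    intro q
    obtain ⟨a, b, ha, hb, rfl, hn⟩ := exists_isNonneg_sub q
    rw [hsub, ← hn, mul_add, ← hnonneg a ha, ← hnonneg b hb]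
    exact norm_sub_le _ _
  refine ⟨LinearMap.mkContinuous
    { toFun := R
      map_add' := fun x y => huniq _ _ ?_
      map_smul' := fun c x => huniq _ _ ?_ } γ⁻¹ hnorm,
    LinearMap.mkContinuous_norm_le _ (inv_nonneg.2 hγ.le) _, fun x y => ⟨fun h => ?_, fun h => ?_⟩, hpos⟩
  · have := Submodule.add_mem _ (hR x) (hR y)
    rw [Prod.mk_add_mk] at this
    convert this using 2
    module
  · have := Submodule.smul_mem _ c (hR x)
    rw [Prod.smul_mk] at this
    rw [RingHom.id_apply]
    convert this using 2
    module
  · exact huniq _ _ (by rwa [sub_sub_cancel])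
  · change R (γ • x - y) = x at h
    have := hR (γ • x - y)
    rwa [h, sub_sub_cancel] at this

end Resolvent

end RepairableSystem

/-! ### Well-posedness of the repairable system -/

theorem corollary2p1 (L lam₁ lam₂ : ℝ) (hL : 0 < L) (hlam₁ : 0 < lam₁) (hlam₂ : 0 < lam₂)
    (μ₁ μ₂ : ℝ → ℝ) (N : ℕ) (hN : 0 < N)
    (hμ₁ : RepairableSystem.IsRepairRate L N μ₁) (hμ₂ : RepairableSystem.IsRepairRate L N μ₂) :
    ∃ T : ℝ → RepairableSystem.X L →L[ℝ] RepairableSystem.X L,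
      RepairableSystem.IsC0Semigroup T ∧
      RepairableSystem.IsGenerator T (RepairableSystem.systemOperator L lam₁ lam₂ μ₁ μ₂) ∧
      ∀ p : RepairableSystem.X L, RepairableSystem.IsNonneg p →
        RepairableSystem.IsMildSolution
          (RepairableSystem.systemOperator L lam₁ lam₂ μ₁ μ₂) p (fun t => T t p) ∧
        (∀ u : ℝ → RepairableSystem.X L,
          RepairableSystem.IsMildSolution
            (RepairableSystem.systemOperator L lam₁ lam₂ μ₁ μ₂) p u →
          ∀ t : ℝ, 0 ≤ t → u t = T t p) ∧
        (p ∈ (RepairableSystem.systemOperator L lam₁ lam₂ μ₁ μ₂).domain →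
          RepairableSystem.IsClassicalSolution
            (RepairableSystem.systemOperator L lam₁ lam₂ μ₁ μ₂) p (fun t => T t p)) ∧
        (∀ u : ℝ → RepairableSystem.X L,
          RepairableSystem.IsClassicalSolution
            (RepairableSystem.systemOperator L lam₁ lam₂ μ₁ μ₂) p u →
          ∀ t : ℝ, 0 ≤ t → u t = T t p) ∧
        (∀ t : ℝ, 0 ≤ t → RepairableSystem.IsNonneg (T t p)) ∧
        (‖p‖ = 1 → ∀ t : ℝ, 0 ≤ t → ‖T t p‖ ≤ 1) := by
  have hex : ∀ γ : ℝ, ∃ R : RepairableSystem.X L →L[ℝ] RepairableSystem.X L, 0 < γ →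
      ‖R‖ ≤ γ⁻¹ ∧
      (∀ x y, (x, y) ∈ (RepairableSystem.systemOperator L lam₁ lam₂ μ₁ μ₂).graph ↔
        R (γ • x - y) = x) ∧
      ∀ x, RepairableSystem.IsNonneg x → RepairableSystem.IsNonneg (R x) := fun γ => by
    by_cases hγ : 0 < γ
    · obtain ⟨R, hR⟩ :=
        RepairableSystem.exists_resolvent (lam₁ := lam₁) hL hlam₁ hlam₂ hμ₁ hμ₂ hγ
      exact ⟨R, fun _ => hR⟩
    -- A default value: only positive `γ` enter the definition of a contractive resolvent.
    · exact ⟨0, fun h => absurd h hγ⟩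
  choose R hR using hex
  have h : RepairableSystem.IsContractiveResolvent
      (RepairableSystem.systemOperator L lam₁ lam₂ μ₁ μ₂) R :=
    ⟨fun γ hγ => (hR γ hγ).1, fun γ hγ => (hR γ hγ).2.1⟩
  have hd := RepairableSystem.dense_domain_systemOperator (lam₁ := lam₁) (lam₂ := lam₂) hL hμ₁ hμ₂
  obtain ⟨T, hT⟩ := h.exists_yosidaLimit hd
  refine ⟨T, h.isC0Semigroup hT hd, h.isGenerator hT hd, fun p hp =>
    ⟨h.isMildSolution hT hd p, fun u hu t ht => h.eq_of_isMildSolution hT hd hu ht,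
      fun hpd => h.isClassicalSolution hT hd hpd, fun u hu t ht =>
        h.eq_of_isMildSolution hT hd (h.isMildSolution_of_isClassicalSolution hu) ht,
      fun t _ => ?_, fun hp1 t _ => ?_⟩⟩
  · exact RepairableSystem.IsContractiveResolvent.yosidaLimit_mem hT
      (RepairableSystem.nonnegCone L) RepairableSystem.isClosed_nonnegCone
      (fun c hc x hx => ⟨mul_nonneg hc hx.1, RepairableSystem.L1.smul_nonneg hc hx.2.1,
        RepairableSystem.L1.smul_nonneg hc hx.2.2⟩)
      (fun γ hγ x hx => (hR γ hγ).2.2 x hx) hp t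
  · exact hp1 ▸ h.norm_yosidaLimit_apply_le hT t p
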